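/- Let $h:[0,\infty)\to[0,\infty)$ be Borel measurable with $\int_0^\infty h(t)\,dt<\infty$, and let $\mu\ge 0$. Let $N^\mu$ be a (non-stationary, linear) Hawkes process with baseline intensity $\mu$ and exciting function $h$, that is, a simple, locally finite point process on $(0,\infty)$ with points $\tau_1<\tau_2<\cdots$, adapted to a filtration on a probability space, whose stochastic intensity with respect to this filtration is $$\lambda(t)=\mu+\sum_{0<\tau_i<t}h(t-\tau_i)$$ (so that $\mathbb{E}\int C_s\,N^\mu(ds)=\mathbb{E}\int_0^\infty C_s\lambda(s)\,ds$ for all nonnegative predictable processes $C$). Write $N^\mu_t$ for the number of points in $(0,t]$. Then the integral equations $$g_1(t)=1+\int_0^t h(t-s)g_1(s)\,ds,\qquad g_2(t)=\int_0^t h(t-s)g_2(s)\,ds+g_1(t)^2\qquad(t\ge 0)$$ have locally integrable solutions $g_1,g_2$ on $[0,\infty)$ (with absolutely convergent integrals), and for all such solutions and every $t\ge 0$ the variable $N^\mu_t$ is square-integrable, with (a) $\mathbb{E}[N^\mu_t]=\mu\int_0^t g_1(s)\,ds$, (b) $\operatorname{Var}[N^\mu_t]=\mu\int_0^t g_2(s)\,ds$.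 -/

import Mathlib

open MeasureTheory ProbabilityTheory Set
open scoped NNReal ENNReal

noncomputable section

namespace Hawkes

variable {Ω : Type*}

/-- The number of points in `(0, t]` of the point process with (possibly infinite) occurrence
times `τ 0, τ 1, …`; a point equal to `∞` never occurs. -/
def count (τ : ℕ → Ω → ℝ≥0∞) (t : ℝ≥0) (ω : Ω) : ℕ :=
  {n : ℕ | τ n ω ≤ (t : ℝ≥0∞)}.ncard

/-- The integral `∫_{(0,∞)} C(s, ω) N(ds)`, the sum of `C` over the points that occur. -/
def pointIntegral (τ : ℕ → Ω → ℝ≥0∞) (C : ℝ≥0 × Ω → ℝ≥0∞) (ω : Ω) : ℝ≥0∞ :=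
  ∑' n : ℕ, if τ n ω < ∞ then C ((τ n ω).toNNReal, ω) else 0

/-- The linear self-exciting intensity
`λ(t) = μ + ∑_{τ i < t} h (t - τ i)`. -/
def intensity (μ : ℝ) (h : ℝ → ℝ) (τ : ℕ → Ω → ℝ≥0∞) (t : ℝ≥0) (ω : Ω) : ℝ≥0∞ :=
  ENNReal.ofReal μ +
    ∑' n : ℕ, if τ n ω < (t : ℝ≥0∞) then ENNReal.ofReal (h ((t : ℝ) - (τ n ω).toReal)) else 0

/-- `τ` lists, in increasing order, the occurrence times of a simple (and locally finite) point
process on `(0, ∞)` adapted to `ℱ`. -/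
structure IsSimplePointProcess [MeasurableSpace Ω] (P : Measure Ω)
    (ℱ : Filtration ℝ≥0 ‹MeasurableSpace Ω›) (τ : ℕ → Ω → ℝ≥0∞) : Prop where
  /-- `N` is adapted: `{N_t ≥ n + 1} = {τ n ≤ t}` is known at time `t`. -/
  adapted : ∀ (n : ℕ) (t : ℝ≥0), MeasurableSet[ℱ t] {ω | τ n ω ≤ (t : ℝ≥0∞)}
  pos : ∀ᵐ ω ∂P, 0 < τ 0 ω
  mono : ∀ᵐ ω ∂P, ∀ n, τ n ω ≤ τ (n + 1) ω
  simple : ∀ᵐ ω ∂P, ∀ n, τ n ω < ∞ → τ n ω < τ (n + 1) ω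
  locallyFinite : ∀ᵐ ω ∂P, ∀ t : ℝ≥0, {n : ℕ | τ n ω ≤ (t : ℝ≥0∞)}.Finite

/-- The process `lam` is an `ℱ`-stochastic intensity of the point process `τ`:
`E ∫ C dN = E ∫ C_s lam_s ds` for every nonnegative `ℱ`-predictable process `C`. -/
def HasStochasticIntensity [MeasurableSpace Ω] (P : Measure Ω)
    (ℱ : Filtration ℝ≥0 ‹MeasurableSpace Ω›) (τ : ℕ → Ω → ℝ≥0∞)
    (lam : ℝ≥0 → Ω → ℝ≥0∞) : Prop :=
  ∀ C : ℝ≥0 × Ω → ℝ≥0∞, Measurable[ℱ.predictable] C →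
    ∫⁻ ω, pointIntegral τ C ω ∂P = ∫⁻ ω, 
      (∫⁻ s in Ioi (0 : ℝ), C (s.toNNReal, ω) * lam s.toNNReal ω) ∂P

/-- The (non-stationary, linear) Hawkes process with empty past, baseline intensity `μ` and
exciting function `h`. -/
structure IsHawkesProcess [MeasurableSpace Ω] (P : Measure Ω)
    (ℱ : Filtration ℝ≥0 ‹MeasurableSpace Ω›) (μ : ℝ) (h : ℝ → ℝ)
    (τ : ℕ → Ω → ℝ≥0∞) : Prop where
  isSimplePointProcess : IsSimplePointProcess P ℱ τ
  hasIntensity : HasStochasticIntensity P ℱ τ (intensity μ h τ)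

/-- `g` is a locally integrable solution on `[0, ∞)` of the Volterra (renewal) equation
`g(t) = f(t) + ∫_0^t h(t - s) g(s) ds`, the integral being absolutely convergent. -/
structure SolvesRenewal (h f g : ℝ → ℝ) : Prop where
  locallyIntegrable : LocallyIntegrableOn g (Ici 0)
  integrable_conv : ∀ t : ℝ, 0 ≤ t →
    IntervalIntegrable (fun s => h (t - s) * g s) volume 0 t
  eq : ∀ t : ℝ, 0 ≤ t → g t = f t + ∫ s in (0 : ℝ)..t, h (t - s) * g s

end Hawkes

end

/-! Write K for h on (0, ∞), extended by zero. If g = f + K * g, inserting the formula for the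
intensity into ∫ g(t - s) λ(s) ds gives, path by path, ∫ g(t - s) λ(s) ds + ∫ f(t - s) N(ds) = μ
∫_0^t g + ∫ g(t - s) N(ds), since a point at a adds (K * g)(t - a) to the first integral
(`lintegral_cutoff_intensity_add`).

For f the indicator of [0, ∞) and g = g₁ this reads N_t - μ ∫_0^t g₁ = Y - A, where Y = ∫ g₁(t - s)
N(ds) and A is its compensator. Taking expectations gives (a). The isometry for compensated
integrals (`lintegral_sq_compensated`) turns the variance into E ∫ g₁(t - s)² λ(s) ds = E ∫ g₁(t -
s)² N(ds), and the expected identity with f = g₁², g = g₂ evaluates this as μ ∫_0^t g₂, which is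
(b).

No moment is known beforehand. Integrands are therefore stopped at the n-th point, where everything
is bounded, and Fatou's lemma removes the stopping. Quantities live in [0, ∞] and identities are
written without subtraction; finiteness is needed only to cancel.

The renewal equations are solved, uniquely, without assuming ∫ h < 1: a weight exp(-θ u) makes
convolution with K a contraction (`exists_discount`). -/

noncomputable section

namespace Hawkes

variable {Ω : Type*}

/-! ### The renewal equation: existence and uniqueness -/

/-- The exciting function on `(0, ∞)`, extended by zero, with values in `[0, ∞]`. -/
def kernel (h : ℝ → ℝ) : ℝ → ℝ≥0∞ := (Ioi 0).indicator fun x => ENNReal.ofReal (h x)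

/-- The convolution `(K * g)(t) = ∫ K(u) g(t - u) du`. -/
def conv (K g : ℝ → ℝ≥0∞) (t : ℝ) : ℝ≥0∞ := ∫⁻ u, K u * g (t - u)

theorem measurable_kernel {h : ℝ → ℝ} (hm : Measurable h) : Measurable (kernel h) :=
  (ENNReal.measurable_ofReal.comp hm).indicator measurableSet_Ioi

theorem kernel_of_nonpos (h : ℝ → ℝ) {x : ℝ} (hx : x ≤ 0) : kernel h x = 0 :=
  indicator_of_notMem (by simpa using hx) _

theorem kernel_of_pos (h : ℝ → ℝ) {x : ℝ} (hx : 0 < x) : kernel h x = ENNReal.ofReal (h x) :=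
  indicator_of_mem (by simpa using hx) _

theorem lintegral_kernel_lt_top {h : ℝ → ℝ} (h_int : IntegrableOn h (Ici 0)) :
    ∫⁻ u, kernel h u < ∞ := by
  rw [kernel, lintegral_indicator measurableSet_Ioi]
  refine lt_of_le_of_lt ?_ (h_int.mono_set Ioi_subset_Ici_self).2
  refine lintegral_mono fun x => ?_
  rw [← ofReal_norm]
  exact ENNReal.ofReal_le_ofReal (le_abs_self _)

theorem measurable_conv {K g : ℝ → ℝ≥0∞} (hK : Measurable K) (hg : Measurable g) :
    Measurable (conv K g) := by
  apply Measurable.lintegral_prod_right'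
    (f := fun p : ℝ × ℝ => K p.2 * g (p.1 - p.2))
  fun_prop

/-- The kernel lives on u > 0, where exp(-n u) tends to 0, so dominated convergence makes the
discounted mass arbitrarily small. This replaces any subcriticality condition. -/
theorem exists_discount {h : ℝ → ℝ} (hm : Measurable h) (h_int : IntegrableOn h (Ici 0)) :
    ∃ θ : ℝ, 0 ≤ θ ∧ ∫⁻ u, kernel h u * ENNReal.ofReal (Real.exp (-θ * u)) ≤ 2⁻¹ := by
  have key : Filter.Tendsto
      (fun n : ℕ => ∫⁻ u, kernel h u * ENNReal.ofReal (Real.exp (-(n : ℝ) * u)))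
      Filter.atTop (nhds (∫⁻ _ : ℝ, 0)) := by
    refine tendsto_lintegral_of_dominated_convergence (kernel h) ?_ ?_
      (lintegral_kernel_lt_top h_int).ne ?_
    · intro n
      exact (measurable_kernel hm).mul (by fun_prop)
    · intro n
      refine Filter.Eventually.of_forall fun u => ?_
      rcases le_or_gt u 0 with hu | hu
      · simp [kernel_of_nonpos h hu]
      · refine mul_le_of_le_one_right' ?_
        rw [ENNReal.ofReal_le_one, Real.exp_le_one_iff]
        nlinarith [n.cast_nonneg (α := ℝ)]
    · refine Filter.Eventually.of_forall fun u => ?_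
      rcases le_or_gt u 0 with hu | hu
      · simp [kernel_of_nonpos h hu]
      · have h1 : Filter.Tendsto (fun n : ℕ => Real.exp (-(n : ℝ) * u)) Filter.atTop (nhds 0) := by
          refine Real.tendsto_exp_atBot.comp ?_
          have : Filter.Tendsto (fun n : ℕ => (n : ℝ) * u) Filter.atTop Filter.atTop :=
            tendsto_natCast_atTop_atTop.atTop_mul_const hu
          simpa [Function.comp_def] using Filter.tendsto_neg_atTop_atBot.comp this
        have h2 := ENNReal.tendsto_ofReal h1
        rw [kernel_of_pos h hu]
        simpa using ENNReal.Tendsto.const_mul h2 (Or.inr ENNReal.ofReal_ne_top)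
  rw [lintegral_zero] at key
  obtain ⟨n, hn⟩ := (key.eventually (gt_mem_nhds (show (0 : ℝ≥0∞) < 2⁻¹ by simp))).exists
  exact ⟨n, n.cast_nonneg, hn.le⟩

theorem conv_le_of_le {K g : ℝ → ℝ≥0∞} {θ : ℝ} {M : ℝ≥0∞} (hK : Measurable K)
    (hθ : ∫⁻ u, K u * ENNReal.ofReal (Real.exp (-θ * u)) ≤ 2⁻¹)
    (hg : ∀ t, g t ≤ M * ENNReal.ofReal (Real.exp (θ * t))) (t : ℝ) :
    conv K g t ≤ (M * 2⁻¹) * ENNReal.ofReal (Real.exp (θ * t)) := by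
  calc conv K g t
      ≤ ∫⁻ u, (M * ENNReal.ofReal (Real.exp (θ * t))) *
          (K u * ENNReal.ofReal (Real.exp (-θ * u))) := by
        refine lintegral_mono fun u => ?_
        refine (mul_le_mul_right (hg (t - u)) (K u)).trans (le_of_eq ?_)
        rw [show θ * (t - u) = θ * t + -θ * u by ring, Real.exp_add,
          ENNReal.ofReal_mul (Real.exp_nonneg _)]
        ring
    _ = (M * ENNReal.ofReal (Real.exp (θ * t))) *
          ∫⁻ u, K u * ENNReal.ofReal (Real.exp (-θ * u)) :=
        lintegral_const_mul _ (hK.mul (by fun_prop))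
    _ ≤ (M * ENNReal.ofReal (Real.exp (θ * t))) * 2⁻¹ := by gcongr
    _ = _ := by ring

theorem conv_of_neg {h : ℝ → ℝ} {g : ℝ → ℝ≥0∞} (hg : ∀ t < 0, g t = 0) {t : ℝ} (ht : t < 0) :
    conv (kernel h) g t = 0 := by
  refine (lintegral_congr fun u => ?_).trans lintegral_zero
  rcases le_or_gt u 0 with hu | hu
  · simp [kernel_of_nonpos h hu]
  · rw [hg _ (by linarith), mul_zero]

/-- The renewal equation with forcing function of at most exponential growth has a solution of at
most exponential growth. -/
theorem exists_renewal {h : ℝ → ℝ} {f : ℝ → ℝ≥0∞} {θ : ℝ} {M : ℝ≥0∞} (hm : Measurable h)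
    (hθ : ∫⁻ u, kernel h u * ENNReal.ofReal (Real.exp (-θ * u)) ≤ 2⁻¹)
    (hf : Measurable f) (hf0 : ∀ t < 0, f t = 0)
    (hfM : ∀ t, f t ≤ M * ENNReal.ofReal (Real.exp (θ * t))) :
    ∃ g : ℝ → ℝ≥0∞, Measurable g ∧ (∀ t < 0, g t = 0) ∧
      (∀ t, g t ≤ (M * 2) * ENNReal.ofReal (Real.exp (θ * t))) ∧
      ∀ t, g t = f t + conv (kernel h) g t := by
  have hK := measurable_kernel hm
  -- Neumann series: `a n` is the n-fold convolution of K applied to f. Each convolution halves the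
  -- bound, and the geometric series accounts for the factor 2.
  let a : ℕ → ℝ → ℝ≥0∞ := fun n => (conv (kernel h))^[n] f
  have a_succ : ∀ n, a (n + 1) = conv (kernel h) (a n) := fun n =>
    Function.iterate_succ_apply' _ _ _
  have a_meas : ∀ n, Measurable (a n) := by
    intro n
    induction n with
    | zero => exact hf
    | succ n ih => rw [a_succ]; exact measurable_conv hK ih
  have a_neg : ∀ n, ∀ t < 0, a n t = 0 := by
    intro n
    induction n with
    | zero => exact hf0
    | succ n ih => rw [a_succ]; exact fun t ht => conv_of_neg ih ht
  have a_le : ∀ n t, a n t ≤ (M * 2⁻¹ ^ n) * ENNReal.ofReal (Real.exp (θ * t)) := by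
    intro n
    induction n with
    | zero => simpa [a] using hfM
    | succ n ih =>
      intro t
      rw [a_succ]
      refine (conv_le_of_le hK hθ ih t).trans (le_of_eq ?_)
      ring
  refine ⟨fun t => ∑' n, a n t, Measurable.tsum a_meas, ?_, ?_, ?_⟩
  · intro t ht
    simp [a_neg _ t ht]
  · intro t
    refine (ENNReal.tsum_le_tsum fun n => a_le n t).trans (le_of_eq ?_)
    rw [ENNReal.tsum_mul_right, ENNReal.tsum_mul_left, ENNReal.tsum_geometric]
    simp
  · intro t
    beta_reduce
    rw [tsum_eq_zero_add' ENNReal.summable]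
    congr 1
    simp_rw [conv, ← ENNReal.tsum_mul_left]
    rw [lintegral_tsum fun n => by
      have := a_meas n
      fun_prop]
    simp_rw [a_succ, conv]

theorem conv_eq_setLIntegral {h : ℝ → ℝ} {g : ℝ → ℝ≥0∞} (hg : ∀ t < 0, g t = 0) (t : ℝ) :
    conv (kernel h) g t = ∫⁻ s in Ioc 0 t, ENNReal.ofReal (h (t - s)) * g s := by
  have h1 : conv (kernel h) g t = ∫⁻ s, kernel h (t - s) * g s := by
    rw [conv, ← lintegral_sub_left_eq_self _ t]
    simp
  rw [h1, ← lintegral_indicator measurableSet_Ioc]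
  refine lintegral_congr_ae ?_
  have h0 : ∀ᵐ s : ℝ, s ≠ 0 := by simp [ae_iff]
  have h2 : ∀ᵐ s : ℝ, s ≠ t := by simp [ae_iff]
  filter_upwards [h0, h2] with s hs0 hst
  by_cases hs : s ∈ Ioc 0 t
  · rw [indicator_of_mem hs, kernel_of_pos h (by linarith [lt_of_le_of_ne hs.2 hst])]
  · rw [indicator_of_notMem hs]
    rcases lt_or_gt_of_ne hs0 with h3 | h3
    · rw [hg s h3, mul_zero]
    · rw [kernel_of_nonpos, zero_mul]
      by_contra hcon
      exact hs ⟨h3, by linarith⟩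

/-- Finiteness of the convolution is read off from the equation itself. The forcing term need agree
with f only on [0, ∞), because it will be the square of an arbitrary solution g₁, which is
determined only there. -/
theorem solvesRenewal_toReal {h : ℝ → ℝ} {f g : ℝ → ℝ≥0∞} {θ : ℝ} {M : ℝ≥0∞} {f' : ℝ → ℝ}
    (h_nonneg : ∀ t : ℝ, 0 ≤ t → 0 ≤ h t) (hm : Measurable h) (hM : M ≠ ∞)
    (hg : Measurable g) (hg0 : ∀ t < 0, g t = 0)
    (hgM : ∀ t, g t ≤ M * ENNReal.ofReal (Real.exp (θ * t)))
    (heq : ∀ t, g t = f t + conv (kernel h) g t) (hf' : ∀ t, 0 ≤ t → f' t = (f t).toReal) :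
    SolvesRenewal h f' (fun t => (g t).toReal) := by
  have hgfin : ∀ t, g t ≠ ∞ := fun t =>
    ne_top_of_le_ne_top (ENNReal.mul_ne_top hM ENNReal.ofReal_ne_top) (hgM t)
  have hconv : ∀ t, ∫⁻ s in Ioc 0 t, ENNReal.ofReal (h (t - s) * (g s).toReal)
      = conv (kernel h) g t := by
    intro t
    rw [conv_eq_setLIntegral hg0]
    refine setLIntegral_congr_fun measurableSet_Ioc fun s hs => ?_
    rw [ENNReal.ofReal_mul (h_nonneg _ (by linarith [hs.2])), ENNReal.ofReal_toReal (hgfin s)]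
  have hcfin : ∀ t, conv (kernel h) g t ≠ ∞ := fun t =>
    ne_top_of_le_ne_top (hgfin t) (by rw [heq t]; exact le_add_self)
  have hffin : ∀ t, f t ≠ ∞ := fun t =>
    ne_top_of_le_ne_top (hgfin t) (by rw [heq t]; exact le_self_add)
  have hae : ∀ t, 0 ≤ᵐ[volume.restrict (Ioc 0 t)] fun s => h (t - s) * (g s).toReal := by
    intro t
    filter_upwards [ae_restrict_mem measurableSet_Ioc] with s hs
    exact mul_nonneg (h_nonneg _ (by linarith [hs.2])) ENNReal.toReal_nonneg
  have hmeas : ∀ t : ℝ, Measurable fun s => h (t - s) * (g s).toReal := fun t =>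
    (hm.comp (by fun_prop)).mul hg.ennreal_toReal
  refine ⟨?_, ?_, ?_⟩
  · refine LocallyIntegrable.locallyIntegrableOn ?_ _
    have hc : Continuous fun t : ℝ => M.toReal * Real.exp (θ * t) := by fun_prop
    refine hc.locallyIntegrable.mono hg.ennreal_toReal.aestronglyMeasurable ?_
    refine Filter.Eventually.of_forall fun t => ?_
    rw [Real.norm_of_nonneg ENNReal.toReal_nonneg, Real.norm_of_nonneg (by positivity)]
    refine (ENNReal.toReal_mono (ENNReal.mul_ne_top hM ENNReal.ofReal_ne_top) (hgM t)).trans_eq ?_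
    rw [ENNReal.toReal_mul, ENNReal.toReal_ofReal (Real.exp_nonneg _)]
  · intro t ht
    rw [intervalIntegrable_iff_integrableOn_Ioc_of_le ht]
    refine ⟨(hmeas t).aestronglyMeasurable, ?_⟩
    rw [hasFiniteIntegral_iff_ofReal (hae t), hconv]
    exact (hcfin t).lt_top
  · intro t ht
    rw [intervalIntegral.integral_of_le ht,
      integral_eq_lintegral_of_nonneg_ae (hae t) (hmeas t).aestronglyMeasurable, hconv, hf' t ht,
      ← ENNReal.toReal_add (hffin t) (hcfin t), ← heq]

/-- By Tonelli and translation invariance, the exponentially weighted integral of D is at most half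
of itself; being finite, it vanishes. -/
theorem ae_eq_zero_of_le_conv {K D : ℝ → ℝ≥0∞} {θ : ℝ} (hK : Measurable K)
    (hθ : ∫⁻ u, K u * ENNReal.ofReal (Real.exp (-θ * u)) ≤ 2⁻¹) (hD : Measurable D)
    (hfin : ∫⁻ t, D t * ENNReal.ofReal (Real.exp (-θ * t)) ≠ ∞)
    (hle : ∀ᵐ t, D t ≤ conv K D t) : D =ᵐ[volume] 0 := by
  let E : ℝ → ℝ≥0∞ := fun t => ENNReal.ofReal (Real.exp (-θ * t))
  have hE : Measurable E := by fun_prop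
  have h1 : ∫⁻ t, D t * E t ≤ 2⁻¹ * ∫⁻ t, D t * E t := by
    calc ∫⁻ t, D t * E t ≤ ∫⁻ t, ∫⁻ u, (K u * E u) * (D (t - u) * E (t - u)) := by
          refine lintegral_mono_ae ?_
          filter_upwards [hle] with t ht
          refine (mul_le_mul_left ht _).trans (le_of_eq ?_)
          rw [conv, ← lintegral_mul_const _ (by fun_prop)]
          refine lintegral_congr fun u => ?_
          have : E t = E u * E (t - u) := by
            simp only [E]
            rw [← ENNReal.ofReal_mul (Real.exp_nonneg _), ← Real.exp_add]
            congr 2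
            ring
          rw [this]
          ring
      _ = ∫⁻ u, ∫⁻ t, (K u * E u) * (D (t - u) * E (t - u)) := by
          refine lintegral_lintegral_swap (Measurable.aemeasurable ?_)
          simp only [Function.uncurry_def]
          fun_prop
      _ = ∫⁻ u, (K u * E u) * ∫⁻ t, D t * E t := by
          refine lintegral_congr fun u => ?_
          rw [lintegral_const_mul _ (by fun_prop),
            lintegral_sub_right_eq_self (fun t => D t * E t)]
      _ = (∫⁻ u, K u * E u) * ∫⁻ t, D t * E t := lintegral_mul_const _ (hK.mul hE)
      _ ≤ 2⁻¹ * ∫⁻ t, D t * E t := by gcongr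
  have h2 : ∫⁻ t, D t * E t = 0 := by
    by_contra h0
    have h3 := (ENNReal.mul_le_mul_iff_left h0 hfin).1 ((one_mul _).le.trans h1)
    simp at h3
  rw [lintegral_eq_zero_iff (by fun_prop)] at h2
  filter_upwards [h2] with t ht
  simpa [E, not_le.2 (Real.exp_pos _)] using ht

theorem SolvesRenewal.unique {h f g g' : ℝ → ℝ} (h_nonneg : ∀ t : ℝ, 0 ≤ t → 0 ≤ h t)
    (hm : Measurable h) (h_int : IntegrableOn h (Ici 0)) (hg : SolvesRenewal h f g)
    (hg' : SolvesRenewal h f g') {T : ℝ} (hT : 0 ≤ T) : g T = g' T := by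
  obtain ⟨θ, hθ0, hθ⟩ := exists_discount hm h_int
  have hK := measurable_kernel hm
  let d : ℝ → ℝ := fun t => g t - g' t
  have hdeq : ∀ t, 0 ≤ t → d t = ∫ s in Ioc 0 t, h (t - s) * d s := by
    intro t ht
    have := intervalIntegral.integral_sub (hg.integrable_conv t ht) (hg'.integrable_conv t ht)
    rw [← intervalIntegral.integral_of_le ht]
    simp only [d, mul_sub, this]
    rw [hg.eq t ht, hg'.eq t ht]
    ring
  have hdint : IntegrableOn d (Icc 0 T) :=
    (hg.locallyIntegrable.integrableOn_compact_subset Icc_subset_Ici_self isCompact_Icc).sub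
      (hg'.locallyIntegrable.integrableOn_compact_subset Icc_subset_Ici_self isCompact_Icc)
  -- Solutions are only locally integrable, so the difference is truncated to [0, T]; the inequality
  -- D ≤ K * D survives because the equation at t involves only times in (0, t].
  let D : ℝ → ℝ≥0∞ := (Icc 0 T).indicator fun t => ‖d t‖ₑ
  have hDm : AEMeasurable D :=
    (aemeasurable_indicator_iff measurableSet_Icc).2 hdint.aestronglyMeasurable.enorm
  have hD0 : ∀ t < 0, D t = 0 := fun t ht =>
    indicator_of_notMem (fun h' => absurd h'.1 (not_le.2 ht)) _
  have hDle : ∀ t, D t ≤ conv (kernel h) D t := by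
    intro t
    by_cases ht : t ∈ Icc 0 T
    · simp only [D, indicator_of_mem ht]
      rw [hdeq t ht.1]
      refine (enorm_integral_le_lintegral_enorm _).trans ?_
      rw [conv_eq_setLIntegral hD0]
      refine setLIntegral_mono' measurableSet_Ioc fun s hs => ?_
      have hs' : s ∈ Icc 0 T := ⟨hs.1.le, hs.2.trans ht.2⟩
      rw [enorm_mul, Real.enorm_of_nonneg (h_nonneg _ (by linarith [hs.2])),
        show D s = _ from indicator_of_mem hs' _]
    · simp [D, indicator_of_notMem ht]
  have hmk : D =ᵐ[volume] hDm.mk D := hDm.ae_eq_mk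
  have hconv : ∀ t, conv (kernel h) D t = conv (kernel h) (hDm.mk D) t := by
    intro t
    refine lintegral_congr_ae ?_
    have := (quasiMeasurePreserving_sub_left_of_right_invariant volume t).ae_eq_comp hmk
    filter_upwards [this] with u hu
    simp only [Function.comp_apply] at hu
    rw [hu]
  have hzero : D =ᵐ[volume] 0 := by
    refine hmk.trans (ae_eq_zero_of_le_conv hK hθ hDm.measurable_mk ?_ ?_)
    · refine ne_top_of_le_ne_top hdint.2.ne ?_
      calc ∫⁻ t, hDm.mk D t * ENNReal.ofReal (Real.exp (-θ * t))
          = ∫⁻ t, D t * ENNReal.ofReal (Real.exp (-θ * t)) := by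
            refine lintegral_congr_ae ?_
            filter_upwards [hmk] with t ht
            rw [ht]
        _ ≤ ∫⁻ t, D t := by
            refine lintegral_mono fun t => ?_
            by_cases ht : t < 0
            · simp [hD0 t ht]
            · refine mul_le_of_le_one_right' ?_
              rw [ENNReal.ofReal_le_one, Real.exp_le_one_iff]
              nlinarith
        _ = _ := lintegral_indicator measurableSet_Icc _
    · filter_upwards [hmk] with t ht
      rw [← ht, ← hconv]
      exact hDle t
  -- From almost everywhere to the given T: D T is bounded by a convolution, which does not see null
  -- sets.
  have hlast : D T ≤ 0 := by
    refine (hDle T).trans (le_of_eq ?_)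
    have := (quasiMeasurePreserving_sub_left_of_right_invariant volume T).ae_eq_comp hzero
    refine (lintegral_congr_ae ?_).trans lintegral_zero
    filter_upwards [this] with u hu
    simp only [Function.comp_apply, Pi.zero_apply] at hu
    rw [hu, mul_zero]
  have hTm : T ∈ Icc 0 T := ⟨hT, le_rfl⟩
  simp only [D, indicator_of_mem hTm, nonpos_iff_eq_zero, enorm_eq_zero, d] at hlast
  linarith

/-! ### Predictability of the intensity and of its ingredients -/

section Predictable

variable {mΩ : MeasurableSpace Ω} {ℱ : Filtration ℝ≥0 mΩ}

theorem measurableSet_predictable_Ioi (a : ℝ≥0) :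
    MeasurableSet[ℱ.predictable] {p : ℝ≥0 × Ω | a < p.1} := by
  convert measurableSet_predictable_Ioi_prod (𝓕 := ℱ) (i := a) (@MeasurableSet.univ Ω (ℱ a)) using 1
  ext p
  simp

theorem measurable_predictable_fst : Measurable[ℱ.predictable] (Prod.fst : ℝ≥0 × Ω → ℝ≥0) := by
  let : MeasurableSpace (ℝ≥0 × Ω) := ℱ.predictable
  refine measurable_of_Ioi fun a => ?_
  exact measurableSet_predictable_Ioi a

/-- The value of σ may be unknown at time t, but its minimum with t is known: for finite a, it is at
most a exactly when t ≤ a, or t > a and σ ≤ a. Later predictability proofs read the points only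
through such minima. -/
theorem measurable_predictable_min {σ : Ω → ℝ≥0∞}
    (hσ : ∀ t : ℝ≥0, MeasurableSet[ℱ t] {ω | σ ω ≤ (t : ℝ≥0∞)}) :
    Measurable[ℱ.predictable] fun p : ℝ≥0 × Ω => min (σ p.2) (p.1 : ℝ≥0∞) := by
  let : MeasurableSpace (ℝ≥0 × Ω) := ℱ.predictable
  refine measurable_of_Iic fun a => ?_
  induction a with
  | top => simp
  | coe a =>
    have : (fun p : ℝ≥0 × Ω => min (σ p.2) (p.1 : ℝ≥0∞)) ⁻¹' Iic (a : ℝ≥0∞) =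
        {p : ℝ≥0 × Ω | a < p.1}ᶜ ∪ Ioi a ×ˢ {ω | σ ω ≤ (a : ℝ≥0∞)} := by
      ext p
      simp only [mem_preimage, mem_Iic, inf_le_iff, ENNReal.coe_le_coe, mem_union, mem_compl_iff,
        mem_ofPred_eq, mem_prod, mem_Ioi, not_lt]
      rcases le_or_gt p.1 a with h | h
      · simp [h]
      · simp [h, not_le.2 h]
    rw [this]
    exact (measurableSet_predictable_Ioi a).compl.union
      (measurableSet_predictable_Ioi_prod (hσ a))

theorem predictable_le_prod : ℱ.predictable ≤ (inferInstance : MeasurableSpace (ℝ≥0 × Ω)) :=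
  measurableSpace_le_predictable_of_measurableSet
    (fun _ hA => (measurableSet_singleton _).prod (ℱ.le _ _ hA))
    (fun _ _ hA => measurableSet_Ioi.prod (ℱ.le _ _ hA))

/-- Allows a predictable process to be frozen at time u and, through `measurable_predictable_after`,
reused as an integrand after u. -/
theorem measurable_section_of_predictable {C : ℝ≥0 × Ω → ℝ≥0∞}
    (hC : Measurable[ℱ.predictable] C) (u : ℝ≥0) : Measurable[ℱ u] fun ω => C (u, ω) := by
  have h1 : @Measurable Ω (Set.Iic u × Ω) (ℱ u) (Subtype.instMeasurableSpace.prod (ℱ u))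
      fun ω => (⟨u, self_mem_Iic⟩, ω) := by
    let := ℱ u
    exact measurable_prodMk_left
  have h2 := (measurable_inclusion_predictable (𝓕 := ℱ) (i := u))
  exact @Measurable.comp _ _ _ (ℱ u) ℱ.predictable _ _ _ hC
    (@Measurable.comp _ _ _ (ℱ u) (Subtype.instMeasurableSpace.prod (ℱ u)) ℱ.predictable _ _ h2 h1)

/-- An `ℱ u`-measurable random variable, used strictly after time `u`, is predictable. -/
theorem measurable_predictable_after {u : ℝ≥0} {X : Ω → ℝ≥0∞} (hX : Measurable[ℱ u] X) :
    Measurable[ℱ.predictable] fun p : ℝ≥0 × Ω => if u < p.1 then X p.2 else 0 := by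
  let : MeasurableSpace (ℝ≥0 × Ω) := ℱ.predictable
  refine measurable_of_Ioi fun a => ?_
  have : (fun p : ℝ≥0 × Ω => if u < p.1 then X p.2 else 0) ⁻¹' Ioi a =
      Ioi u ×ˢ (X ⁻¹' Ioi a) := by
    ext p
    by_cases h : u < p.1 <;> simp [h]
  rw [this]
  exact measurableSet_predictable_Ioi_prod (hX measurableSet_Ioi)

theorem measurable_of_adapted {σ : Ω → ℝ≥0∞}
    (hσ : ∀ t : ℝ≥0, MeasurableSet[ℱ t] {ω | σ ω ≤ (t : ℝ≥0∞)}) : Measurable σ := by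
  refine measurable_of_Iic fun a => ?_
  induction a with
  | top => simp
  | coe a => exact ℱ.le _ _ (hσ a)

theorem measurable_intensity_of_min {α : Type*} [MeasurableSpace α] {h : ℝ → ℝ} (μ : ℝ)
    (hm : Measurable h) {x : α → ℝ≥0} {m : ℕ → α → ℝ≥0∞} (hx : Measurable x)
    (hmin : ∀ n, Measurable (m n)) :
    Measurable fun a => ENNReal.ofReal μ +
      ∑' n : ℕ, if m n a < (x a : ℝ≥0∞) then
        ENNReal.ofReal (h ((x a : ℝ) - (m n a).toReal)) else 0 := by
  refine Measurable.const_add ?_ _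
  refine Measurable.tsum fun n => ?_
  refine Measurable.ite (measurableSet_lt (hmin n) (by fun_prop)) ?_ measurable_const
  exact ENNReal.measurable_ofReal.comp
    (hm.comp ((measurable_coe_nnreal_real.comp hx).sub (hmin n).ennreal_toReal))

theorem measurable_predictable_intensity {τ : ℕ → Ω → ℝ≥0∞} {h : ℝ → ℝ} (μ : ℝ)
    (hm : Measurable h)
    (hτ : ∀ (n : ℕ) (t : ℝ≥0), MeasurableSet[ℱ t] {ω | τ n ω ≤ (t : ℝ≥0∞)}) :
    Measurable[ℱ.predictable] fun p : ℝ≥0 × Ω => intensity μ h τ p.1 p.2 := by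
  -- Replacing `τ n` by its minimum with t is harmless: if `τ n` < t nothing changes, and otherwise
  -- the minimum is t and the strict inequality still fails.
  convert @measurable_intensity_of_min _ ℱ.predictable h μ hm _ _ measurable_predictable_fst
    (fun n => measurable_predictable_min (hτ n)) using 1
  funext p
  rw [intensity]
  congr 1
  refine tsum_congr fun n => ?_
  by_cases hlt : τ n p.2 < (p.1 : ℝ≥0∞)
  · simp [hlt, min_eq_left hlt.le]
  · simp [hlt]

end Predictable

/-! ### Lebesgue measure on the half-line, and squares as sums over ordered pairs -/

/-- Lebesgue measure on the positive half-line. -/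
def halfLine : Measure ℝ≥0 := (volume.restrict (Ioi (0 : ℝ))).map Real.toNNReal

theorem lintegral_halfLine {F : ℝ≥0 → ℝ≥0∞} (hF : Measurable F) :
    ∫⁻ s, F s ∂halfLine = ∫⁻ s in Ioi (0 : ℝ), F s.toNNReal :=
  lintegral_map hF (by fun_prop)

instance : SFinite halfLine := by
  unfold halfLine
  infer_instance

instance : NullSingletonClass halfLine := by
  refine ⟨fun x => ?_⟩
  rw [halfLine, Measure.map_apply (by fun_prop) (measurableSet_singleton x),
    Measure.restrict_apply (measurableSet_singleton x |>.preimage (by fun_prop))]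
  refine measure_mono_null (t := {(x : ℝ)}) ?_ (by simp)
  rintro y ⟨hy, hy0⟩
  simp only [mem_preimage, mem_singleton_iff] at hy ⊢
  rw [← hy, Real.coe_toNNReal _ (le_of_lt hy0)]

theorem sq_tsum (y : ℕ → ℝ≥0∞) :
    (∑' i, y i) ^ 2 = ∑' i, (y i ^ 2 + 2 * (y i * ∑' j, if j < i then y j else 0)) := by
  have h1 : ∀ i, y i * ∑' j, y j = y i ^ 2 + (y i * ∑' j, if j < i then y j else 0) +
      ∑' j, if i < j then y i * y j else 0 := by
    intro i
    have h2 : y i ^ 2 = ∑' j, if j = i then y i * y j else 0 := by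
      rw [tsum_ite_eq, sq]
    rw [h2, ← ENNReal.tsum_mul_left, ← ENNReal.tsum_mul_left, ← ENNReal.tsum_add,
      ← ENNReal.tsum_add]
    refine tsum_congr fun j => ?_
    rcases lt_trichotomy j i with h | h | h
    · simp [h, h.ne, h.not_gt]
    · simp [h]
    · simp [h, h.ne', h.not_gt]
  have h3 : ∑' i, ∑' j, (if i < j then y i * y j else 0) =
      ∑' i, y i * ∑' j, if j < i then y j else 0 := by
    rw [ENNReal.tsum_comm]
    refine tsum_congr fun i => ?_
    rw [← ENNReal.tsum_mul_left]
    refine tsum_congr fun j => ?_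
    split_ifs <;> simp [mul_comm]
  rw [sq, ← ENNReal.tsum_mul_right]
  simp_rw [h1]
  rw [ENNReal.tsum_add, h3, ← ENNReal.tsum_add]
  refine tsum_congr fun i => ?_
  ring

/-- The diagonal is null for an atomless measure, and the two triangles have equal mass. In
`sq_tsum` the diagonal survives; it is the source of the variance. -/
theorem sq_lintegral {ν : Measure ℝ≥0} [SFinite ν] [NullSingletonClass ν] {K : ℝ≥0 → ℝ≥0∞}
    (hK : Measurable K) :
    (∫⁻ s, K s ∂ν) ^ 2 = 2 * ∫⁻ s, ∫⁻ u, (if u < s then K s * K u else 0) ∂ν ∂ν := by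
  have hm1 : Measurable fun p : ℝ≥0 × ℝ≥0 => if p.2 < p.1 then K p.1 * K p.2 else 0 :=
    Measurable.ite (measurableSet_lt measurable_snd measurable_fst) (by fun_prop) measurable_const
  have hm2 : Measurable fun p : ℝ≥0 × ℝ≥0 => if p.1 < p.2 then K p.1 * K p.2 else 0 :=
    Measurable.ite (measurableSet_lt measurable_fst measurable_snd) (by fun_prop) measurable_const
  have h1 : ∀ s, K s * ∫⁻ u, K u ∂ν = ∫⁻ u, (if u < s then K s * K u else 0) ∂ν +
      ∫⁻ u, (if s < u then K s * K u else 0) ∂ν := by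
    intro s
    rw [← lintegral_const_mul _ hK, ← lintegral_add_left (by exact hm1.comp measurable_prodMk_left)]
    refine lintegral_congr_ae ?_
    have : ∀ᵐ u ∂ν, u ≠ s := by simp [ae_iff]
    filter_upwards [this] with u hu
    rcases lt_or_gt_of_ne hu with h | h
    · simp [h, h.not_gt]
    · simp [h, h.not_gt]
  rw [sq, ← lintegral_mul_const _ hK]
  simp_rw [h1]
  rw [lintegral_add_left (by exact hm1.lintegral_prod_right'), two_mul]
  congr 1
  rw [lintegral_lintegral_swap (by exact hm2.aemeasurable)]
  simp_rw [mul_comm]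

/-! ### The isometry for compensated point integrals -/

section Isometry

variable {mΩ : MeasurableSpace Ω} {P : Measure Ω} {ℱ : Filtration ℝ≥0 mΩ} {τ : ℕ → Ω → ℝ≥0∞}

theorem IsSimplePointProcess.ae_lt_iff (hτ : IsSimplePointProcess P ℱ τ) :
    ∀ᵐ ω ∂P, ∀ i j, τ i ω < ∞ → (τ j ω < τ i ω ↔ j < i) := by
  filter_upwards [hτ.mono, hτ.simple] with ω h1 h2 i j hi
  have hmono : Monotone fun n => τ n ω := monotone_nat_of_le_succ h1
  constructor
  · intro hlt
    by_contra hji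
    exact absurd hlt (not_lt.2 (hmono (not_lt.1 hji)))
  · intro hji
    have hj : τ j ω < ∞ := lt_of_le_of_lt (hmono hji.le) hi
    exact lt_of_lt_of_le (h2 j hj) (hmono hji)

theorem measurable_pointIntegral (hτ : IsSimplePointProcess P ℱ τ) {C : ℝ≥0 × Ω → ℝ≥0∞}
    (hC : Measurable C) : Measurable (pointIntegral τ C) := by
  have hτm : ∀ n, Measurable (τ n) := fun n => measurable_of_adapted (hτ.adapted n)
  refine Measurable.tsum fun n => ?_
  refine Measurable.ite (measurableSet_lt (hτm n) measurable_const) ?_ measurable_const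
  exact hC.comp ((hτm n).ennreal_toNNReal.prodMk measurable_id)

/-- The running integral `∫_{(0,s)} H dN`. -/
def runningIntegral (τ : ℕ → Ω → ℝ≥0∞) (H : ℝ≥0 × Ω → ℝ≥0∞) (p : ℝ≥0 × Ω) : ℝ≥0∞ :=
  ∑' i : ℕ, if τ i p.2 < (p.1 : ℝ≥0∞) then H ((τ i p.2).toNNReal, p.2) else 0

theorem HasStochasticIntensity.lintegral_eq {lam : ℝ≥0 → Ω → ℝ≥0∞}
    (hint : HasStochasticIntensity P ℱ τ lam)
    (hlam : Measurable fun p : ℝ≥0 × Ω => lam p.1 p.2) {C : ℝ≥0 × Ω → ℝ≥0∞}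
    (hC : Measurable[ℱ.predictable] C) :
    ∫⁻ ω, pointIntegral τ C ω ∂P = ∫⁻ ω, ∫⁻ s, C (s, ω) * lam s ω ∂halfLine ∂P := by
  rw [hint C hC]
  refine lintegral_congr fun ω => ?_
  have hC' : Measurable C := hC.mono predictable_le_prod le_rfl
  rw [lintegral_halfLine (F := fun s => C (s, ω) * lam s ω)]
  exact (hC'.comp measurable_prodMk_right).mul (hlam.comp measurable_prodMk_right)

/-- Pairs of points are grouped by the later one. Strict ordering of the points turns the index
condition j < i into the time condition in `runningIntegral`, so the square is again a point
integral, now of H² + 2 H R with R the running integral. -/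
theorem sq_pointIntegral {H : ℝ≥0 × Ω → ℝ≥0∞} {ω : Ω}
    (hlt : ∀ i j, τ i ω < ∞ → (τ j ω < τ i ω ↔ j < i)) :
    pointIntegral τ H ω ^ 2 =
      pointIntegral τ (fun p => H p ^ 2 + 2 * (H p * runningIntegral τ H p)) ω := by
  rw [pointIntegral, sq_tsum]
  refine tsum_congr fun i => ?_
  by_cases hi : τ i ω < ∞
  · simp only [hi, if_true]
    congr 3
    refine tsum_congr fun j => ?_
    simp only [ENNReal.coe_toNNReal hi.ne, hlt i j hi]
    by_cases hji : j < i
    · simp [hji, ((hlt i j hi).2 hji).trans hi]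
    · simp [hji]
  · simp [hi]

/-- Integration by parts: a point s and a time u are compared, and u = s is negligible because the
measure has no atoms. -/
theorem pointIntegral_mul_lintegral {H : ℝ≥0 × Ω → ℝ≥0∞}
    {ν : Measure ℝ≥0} [NullSingletonClass ν] {K : ℝ≥0 → ℝ≥0∞} (hK : Measurable K) (ω : Ω) :
    pointIntegral τ H ω * ∫⁻ u, K u ∂ν =
      ∫⁻ u, pointIntegral τ (fun p => H p * if u < p.1 then K u else 0) ω ∂ν +
        ∫⁻ u, K u * runningIntegral τ H (u, ω) ∂ν := by
  have hm1 : ∀ a : ℝ≥0, Measurable fun u => if u < a then K u else 0 := fun a =>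
    Measurable.ite measurableSet_Iio hK measurable_const
  have hm2 : ∀ i, Measurable fun u : ℝ≥0 =>
      K u * if τ i ω < (u : ℝ≥0∞) then H ((τ i ω).toNNReal, ω) else 0 := fun i =>
    hK.mul (Measurable.ite (measurableSet_lt measurable_const (by fun_prop)) measurable_const
      measurable_const)
  have hm3 : ∀ i, Measurable fun u : ℝ≥0 => if τ i ω < ∞ then H ((τ i ω).toNNReal, ω) *
      (if u < (τ i ω).toNNReal then K u else 0) else 0 := by
    intro i
    by_cases hi : τ i ω < ∞
    · simp only [hi, if_true]
      exact (hm1 _).const_mul _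
    · simp [hi]
  simp only [pointIntegral, runningIntegral]
  simp_rw [← ENNReal.tsum_mul_left]
  rw [← ENNReal.tsum_mul_right, lintegral_tsum fun i => (hm3 i).aemeasurable,
    lintegral_tsum fun i => (hm2 i).aemeasurable, ← ENNReal.tsum_add]
  refine tsum_congr fun i => ?_
  by_cases hi : τ i ω < ∞
  · simp only [hi, if_true]
    rw [← lintegral_const_mul _ hK, ← lintegral_add_left ((hm1 _).const_mul _)]
    refine lintegral_congr_ae ?_
    have : ∀ᵐ u ∂ν, u ≠ (τ i ω).toNNReal := by simp [ae_iff]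
    filter_upwards [this] with u hu
    have hcoe : τ i ω < (u : ℝ≥0∞) ↔ (τ i ω).toNNReal < u := by
      rw [← ENNReal.coe_lt_coe, ENNReal.coe_toNNReal hi.ne]
    simp only [hcoe]
    rcases lt_or_gt_of_ne hu with h | h
    · simp [h, h.not_gt]
    · simp [h, h.not_gt, mul_comm]
  · have htop : τ i ω = ∞ := by simpa using hi
    simp [htop]

/-- The isometry for the compensated integral, with `Y = ∫ H dN` and `A = ∫ H lam ds`, written
without subtraction: `E[Y²] + E[A²] = E ∫ H² lam ds + 2 E[Y A]`. -/
theorem lintegral_sq_add_lintegral_sq [SFinite P] {lam : ℝ≥0 → Ω → ℝ≥0∞}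
    (hτ : IsSimplePointProcess P ℱ τ) (hint : HasStochasticIntensity P ℱ τ lam)
    (hlam : Measurable[ℱ.predictable] fun p : ℝ≥0 × Ω => lam p.1 p.2)
    {H : ℝ≥0 × Ω → ℝ≥0∞} (hH : Measurable[ℱ.predictable] H)
    (hrun : Measurable[ℱ.predictable] (runningIntegral τ H)) :
    ∫⁻ ω, pointIntegral τ H ω ^ 2 ∂P + ∫⁻ ω, (∫⁻ s, H (s, ω) * lam s ω ∂halfLine) ^ 2 ∂P =
      ∫⁻ ω, ∫⁻ s, H (s, ω) ^ 2 * lam s ω ∂halfLine ∂P +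
        2 * ∫⁻ ω, pointIntegral τ H ω * ∫⁻ s, H (s, ω) * lam s ω ∂halfLine ∂P := by
  have hlam' : Measurable fun p : ℝ≥0 × Ω => lam p.1 p.2 := hlam.mono predictable_le_prod le_rfl
  have hH' : Measurable H := hH.mono predictable_le_prod le_rfl
  have hrun' : Measurable (runningIntegral τ H) := hrun.mono predictable_le_prod le_rfl
  have hτm : ∀ n, Measurable (τ n) := fun n => measurable_of_adapted (hτ.adapted n)
  let K : ℝ≥0 × Ω → ℝ≥0∞ := fun p => H p * lam p.1 p.2
  have hKp : Measurable[ℱ.predictable] K := by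
    let : MeasurableSpace (ℝ≥0 × Ω) := ℱ.predictable
    exact hH.mul hlam
  have hK : Measurable K := hH'.mul hlam'
  have hKω : ∀ ω, Measurable fun s => K (s, ω) := fun ω => hK.comp measurable_prodMk_right
  -- With K = H lam, the three moments become E[A²] = 2 I₁, E[Y²] = E ∫ H² lam ds + 2 I₂ and E[Y A]
  -- = I₁ + I₂, which combine to the claim.
  let I₁ := ∫⁻ ω, ∫⁻ s, ∫⁻ u, (if u < s then K (s, ω) * K (u, ω) else 0) ∂halfLine ∂halfLine ∂P
  let I₂ := ∫⁻ ω, ∫⁻ s, K (s, ω) * runningIntegral τ H (s, ω) ∂halfLine ∂P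
  have hmtri : Measurable fun q : (Ω × ℝ≥0) × ℝ≥0 =>
      if q.2 < q.1.2 then K (q.1.2, q.1.1) * K (q.2, q.1.1) else 0 :=
    Measurable.ite (measurableSet_lt (by fun_prop) (by fun_prop)) (by fun_prop) measurable_const
  have hA : ∫⁻ ω, (∫⁻ s, K (s, ω) ∂halfLine) ^ 2 ∂P = 2 * I₁ := by
    simp_rw [sq_lintegral (hKω _)]
    refine lintegral_const_mul _ ?_
    exact (hmtri.lintegral_prod_right').lintegral_prod_right'
  have hY : ∫⁻ ω, pointIntegral τ H ω ^ 2 ∂P =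
      ∫⁻ ω, ∫⁻ s, H (s, ω) ^ 2 * lam s ω ∂halfLine ∂P + 2 * I₂ := by
    have h1 : ∫⁻ ω, pointIntegral τ H ω ^ 2 ∂P = ∫⁻ ω, pointIntegral τ
        (fun p => H p ^ 2 + 2 * (H p * runningIntegral τ H p)) ω ∂P := by
      refine lintegral_congr_ae ?_
      filter_upwards [hτ.ae_lt_iff] with ω hω using sq_pointIntegral hω
    have hpred : Measurable[ℱ.predictable]
        fun p => H p ^ 2 + 2 * (H p * runningIntegral τ H p) := by
      let : MeasurableSpace (ℝ≥0 × Ω) := ℱ.predictable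
      exact (hH.pow_const 2).add ((hH.mul hrun).const_mul 2)
    rw [h1, hint.lintegral_eq hlam' hpred]
    have hm : Measurable fun p : ℝ≥0 × Ω => H p ^ 2 * lam p.1 p.2 := (hH'.pow_const 2).mul hlam'
    have hmω : ∀ ω, Measurable fun s => H (s, ω) ^ 2 * lam s ω := fun ω =>
      hm.comp measurable_prodMk_right
    have hKR : ∀ ω, Measurable fun s => K (s, ω) * runningIntegral τ H (s, ω) := fun ω =>
      (hKω ω).mul (hrun'.comp measurable_prodMk_right)
    have h2 : ∀ ω, ∫⁻ s, (H (s, ω) ^ 2 + 2 * (H (s, ω) * runningIntegral τ H (s, ω))) * lam s ω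
        ∂halfLine = ∫⁻ s, H (s, ω) ^ 2 * lam s ω ∂halfLine +
          2 * ∫⁻ s, K (s, ω) * runningIntegral τ H (s, ω) ∂halfLine := by
      intro ω
      rw [← lintegral_const_mul _ (hKR ω),
        ← lintegral_add_left (hmω ω)]
      refine lintegral_congr fun s => ?_
      simp only [K]
      ring
    simp_rw [h2]
    rw [lintegral_add_left (by exact (hm.comp measurable_swap).lintegral_prod_right'),
      lintegral_const_mul]
    exact ((hK.mul hrun').comp measurable_swap).lintegral_prod_right'
  have hYA : ∫⁻ ω, pointIntegral τ H ω * ∫⁻ s, K (s, ω) ∂halfLine ∂P = I₁ + I₂ := by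
    simp_rw [pointIntegral_mul_lintegral (hKω _)]
    have hmR : Measurable fun ω => ∫⁻ u, K (u, ω) * runningIntegral τ H (u, ω) ∂halfLine :=
      ((hK.mul hrun').comp measurable_swap).lintegral_prod_right'
    rw [lintegral_add_right _ hmR]
    congr 1
    have hmL : Measurable fun q : Ω × ℝ≥0 =>
        pointIntegral τ (fun p => H p * if q.2 < p.1 then K (q.2, q.1) else 0) q.1 := by
      refine Measurable.tsum fun n => ?_
      have hn : Measurable fun q : Ω × ℝ≥0 => τ n q.1 := (hτm n).comp measurable_fst
      refine Measurable.ite (measurableSet_lt hn measurable_const) ?_ measurable_const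
      refine (hH'.comp (hn.ennreal_toNNReal.prodMk measurable_fst)).mul ?_
      exact Measurable.ite (measurableSet_lt measurable_snd hn.ennreal_toNNReal)
        (hK.comp measurable_swap) measurable_const
    have hslice : ∀ u ω, pointIntegral τ (fun p => H p * if u < p.1 then K (u, ω) else 0) ω =
        pointIntegral τ (fun p => H p * if u < p.1 then K (u, p.2) else 0) ω := fun _ _ => rfl
    rw [lintegral_lintegral_swap (by exact hmL.aemeasurable)]
    -- For fixed u, the factor K(u, ·) is known at time u, so the integrand restricted to times
    -- after u is predictable and N(ds) may be replaced by lam ds.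
    have hu : ∀ u, ∫⁻ ω, pointIntegral τ (fun p => H p * if u < p.1 then K (u, ω) else 0) ω ∂P =
        ∫⁻ ω, ∫⁻ s, (if u < s then K (s, ω) * K (u, ω) else 0) ∂halfLine ∂P := by
      intro u
      have hp : Measurable[ℱ.predictable]
          fun p : ℝ≥0 × Ω => H p * if u < p.1 then K (u, p.2) else 0 := by
        have hafter := measurable_predictable_after (measurable_section_of_predictable hKp u)
        let : MeasurableSpace (ℝ≥0 × Ω) := ℱ.predictable
        exact hH.mul hafter
      simp_rw [hslice]
      rw [hint.lintegral_eq hlam' hp]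
      refine lintegral_congr fun ω => lintegral_congr fun s => ?_
      simp only [K]
      split_ifs
      · ring
      · simp
    simp_rw [hu]
    rw [lintegral_lintegral_swap (f := fun u ω => ∫⁻ s, (if u < s then K (s, ω) * K (u, ω) else 0)
      ∂halfLine)]
    · refine lintegral_congr fun ω => ?_
      refine lintegral_lintegral_swap (Measurable.aemeasurable ?_)
      exact Measurable.ite (measurableSet_lt (by fun_prop) (by fun_prop))
        ((hKω ω).comp measurable_snd |>.mul ((hKω ω).comp measurable_fst)) measurable_const
    · have hm : Measurable fun q : (ℝ≥0 × Ω) × ℝ≥0 =>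
          if q.1.1 < q.2 then K (q.2, q.1.2) * K (q.1.1, q.1.2) else 0 :=
        Measurable.ite (measurableSet_lt (by fun_prop) (by fun_prop)) (by fun_prop)
          measurable_const
      exact hm.lintegral_prod_right'.aemeasurable
  change _ + ∫⁻ ω, (∫⁻ s, K (s, ω) ∂halfLine) ^ 2 ∂P = _ +
    2 * ∫⁻ ω, pointIntegral τ H ω * ∫⁻ s, K (s, ω) ∂halfLine ∂P
  rw [hA, hY, hYA]
  ring

end Isometry

theorem ofReal_sub_sq_add {y a : ℝ≥0∞} (hy : y ≠ ∞) (ha : a ≠ ∞) :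
    ENNReal.ofReal ((y.toReal - a.toReal) ^ 2) + 2 * (y * a) = y ^ 2 + a ^ 2 := by
  lift y to ℝ≥0 using hy
  lift a to ℝ≥0 using ha
  rw [← ENNReal.toReal_eq_toReal_iff' (by finiteness) (by finiteness),
    ENNReal.toReal_add (by finiteness) (by finiteness),
    ENNReal.toReal_add (by finiteness) (by finiteness), ENNReal.toReal_ofReal (by positivity)]
  simp
  ring

section Isometry

variable {mΩ : MeasurableSpace Ω} {P : Measure Ω} {ℱ : Filtration ℝ≥0 mΩ} {τ : ℕ → Ω → ℝ≥0∞}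

/-- The second moments serve only to make 2 E[Y A] ≤ E[Y²] + E[A²] finite, so that it can be
cancelled. -/
theorem lintegral_sq_compensated [SFinite P] {lam : ℝ≥0 → Ω → ℝ≥0∞}
    (hτ : IsSimplePointProcess P ℱ τ) (hint : HasStochasticIntensity P ℱ τ lam)
    (hlam : Measurable[ℱ.predictable] fun p : ℝ≥0 × Ω => lam p.1 p.2)
    {H : ℝ≥0 × Ω → ℝ≥0∞} (hH : Measurable[ℱ.predictable] H)
    (hrun : Measurable[ℱ.predictable] (runningIntegral τ H))
    (hY : ∫⁻ ω, pointIntegral τ H ω ^ 2 ∂P ≠ ∞)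
    (hA : ∫⁻ ω, (∫⁻ s, H (s, ω) * lam s ω ∂halfLine) ^ 2 ∂P ≠ ∞) :
    ∫⁻ ω, ENNReal.ofReal (((pointIntegral τ H ω).toReal -
        (∫⁻ s, H (s, ω) * lam s ω ∂halfLine).toReal) ^ 2) ∂P =
      ∫⁻ ω, ∫⁻ s, H (s, ω) ^ 2 * lam s ω ∂halfLine ∂P := by
  have hH' : Measurable H := hH.mono predictable_le_prod le_rfl
  have hlam' : Measurable fun p : ℝ≥0 × Ω => lam p.1 p.2 := hlam.mono predictable_le_prod le_rfl
  have hYm := measurable_pointIntegral hτ hH'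
  have hAm : Measurable fun ω => ∫⁻ s, H (s, ω) * lam s ω ∂halfLine :=
    ((hH'.mul hlam').comp measurable_swap).lintegral_prod_right'
  have hiso := lintegral_sq_add_lintegral_sq hτ hint hlam hH hrun
  set Y := pointIntegral τ H
  set A := fun ω => ∫⁻ s, H (s, ω) * lam s ω ∂halfLine
  have hae : ∀ᵐ ω ∂P, ENNReal.ofReal (((Y ω).toReal - (A ω).toReal) ^ 2) + 2 * (Y ω * A ω) =
      Y ω ^ 2 + A ω ^ 2 := by
    filter_upwards [ae_lt_top (hYm.pow_const 2) hY, ae_lt_top (hAm.pow_const 2) hA] with ω h1 h2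
    have h1' : Y ω < ∞ := by simpa using h1
    have h2' : A ω < ∞ := by simpa using h2
    exact ofReal_sub_sq_add h1'.ne h2'.ne
  have hsum : ∫⁻ ω, ENNReal.ofReal (((Y ω).toReal - (A ω).toReal) ^ 2) ∂P +
      2 * ∫⁻ ω, Y ω * A ω ∂P = ∫⁻ ω, Y ω ^ 2 ∂P + ∫⁻ ω, A ω ^ 2 ∂P := by
    rw [← lintegral_const_mul _ (by fun_prop), ← lintegral_add_right _ (by fun_prop),
      ← lintegral_add_left (hYm.pow_const 2)]
    exact lintegral_congr_ae hae
  have hYA : 2 * ∫⁻ ω, Y ω * A ω ∂P ≠ ∞ := by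
    refine ne_top_of_le_ne_top (ENNReal.add_ne_top.2 ⟨hY, hA⟩) ?_
    exact le_add_self.trans hsum.le
  exact (ENNReal.add_left_inj hYA).1 (hsum.trans hiso)

end Isometry

/-! ### Localization and stopped integrands -/

/-- Fatou's lemma in the form used to remove the stopping at `τ n`: the rank from which F n = G may
depend on ω. -/
theorem lintegral_le_of_eventually_eq [MeasurableSpace Ω] {P : Measure Ω} {F : ℕ → Ω → ℝ≥0∞}
    {G : Ω → ℝ≥0∞} {B : ℝ≥0∞} (hF : ∀ n, Measurable (F n))
    (hFG : ∀ᵐ ω ∂P, ∀ᶠ n in Filter.atTop, F n ω = G ω) (hB : ∀ n, ∫⁻ ω, F n ω ∂P ≤ B) :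
    ∫⁻ ω, G ω ∂P ≤ B := by
  calc ∫⁻ ω, G ω ∂P = ∫⁻ ω, Filter.liminf (fun n => F n ω) Filter.atTop ∂P := by
        refine lintegral_congr_ae ?_
        filter_upwards [hFG] with ω hω
        rw [Filter.liminf_congr hω, Filter.liminf_const]
    _ ≤ Filter.liminf (fun n => ∫⁻ ω, F n ω ∂P) Filter.atTop := lintegral_liminf_le hF
    _ ≤ B := (Filter.liminf_le_liminf (Filter.Eventually.of_forall hB)).trans
        (Filter.liminf_const B).le

/-- The integrand `s ↦ f (t - s)`, stopped at the random time `σ`. -/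
def cutoff (f : ℝ → ℝ≥0∞) (t : ℝ≥0) (σ : Ω → ℝ≥0∞) (p : ℝ≥0 × Ω) : ℝ≥0∞ :=
  if (p.1 : ℝ≥0∞) ≤ σ p.2 then f ((t : ℝ) - (p.1 : ℝ)) else 0

theorem cutoff_top (f : ℝ → ℝ≥0∞) (t : ℝ≥0) (p : ℝ≥0 × Ω) :
    cutoff f t (fun _ => ∞) p = f ((t : ℝ) - (p.1 : ℝ)) := by
  simp [cutoff]

theorem cutoff_le_top (f : ℝ → ℝ≥0∞) (t : ℝ≥0) (σ : Ω → ℝ≥0∞) (p : ℝ≥0 × Ω) :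
    cutoff f t σ p ≤ cutoff f t (fun _ => ∞) p := by
  rw [cutoff_top, cutoff]
  split_ifs <;> simp

theorem cutoff_eq_top {f : ℝ → ℝ≥0∞} (hf0 : ∀ t < 0, f t = 0) {t : ℝ≥0} {σ : Ω → ℝ≥0∞}
    {p : ℝ≥0 × Ω} (hσ : (t : ℝ≥0∞) < σ p.2) :
    cutoff f t σ p = cutoff f t (fun _ => ∞) p := by
  rw [cutoff_top, cutoff]
  split_ifs with h
  · rfl
  · rw [hf0]
    have : t < p.1 := by
      rw [← ENNReal.coe_lt_coe]
      exact hσ.trans (not_le.1 h)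
    simpa using this

theorem pointIntegral_mono (τ : ℕ → Ω → ℝ≥0∞) {C D : ℝ≥0 × Ω → ℝ≥0∞} {ω : Ω}
    (h : ∀ s, C (s, ω) ≤ D (s, ω)) : pointIntegral τ C ω ≤ pointIntegral τ D ω := by
  refine ENNReal.tsum_le_tsum fun i => ?_
  split_ifs
  · exact h _
  · exact le_rfl

theorem pointIntegral_congr (τ : ℕ → Ω → ℝ≥0∞) {C D : ℝ≥0 × Ω → ℝ≥0∞} {ω : Ω}
    (h : ∀ s, C (s, ω) = D (s, ω)) : pointIntegral τ C ω = pointIntegral τ D ω := by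
  simp_rw [pointIntegral, h]

section Predictable

variable {mΩ : MeasurableSpace Ω} {ℱ : Filtration ℝ≥0 mΩ}

theorem measurable_ite_le_comp_sub {α : Type*} [MeasurableSpace α] {f : ℝ → ℝ≥0∞}
    (hf : Measurable f) (t : ℝ) {m q : α → ℝ≥0∞} (hm : Measurable m) (hq : Measurable q) :
    Measurable fun a => if m a ≤ q a then f (t - (m a).toReal) else 0 :=
  Measurable.ite (measurableSet_le hm hq)
    (hf.comp (measurable_const.sub hm.ennreal_toReal)) measurable_const

theorem measurable_ite_lt {α : Type*} [MeasurableSpace α] {f m q : α → ℝ≥0∞}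
    (hf : Measurable f) (hm : Measurable m) (hq : Measurable q) :
    Measurable fun a => if m a < q a then f a else 0 :=
  Measurable.ite (measurableSet_lt hm hq) hf measurable_const

theorem measurable_predictable_coe_fst :
    Measurable[ℱ.predictable] fun p : ℝ≥0 × Ω => (p.1 : ℝ≥0∞) := by
  have hfst := measurable_predictable_fst (ℱ := ℱ)
  let : MeasurableSpace (ℝ≥0 × Ω) := ℱ.predictable
  exact hfst.coe_nnreal_ennreal

theorem measurable_predictable_cutoff {f : ℝ → ℝ≥0∞} (hf : Measurable f) (t : ℝ≥0)
    {σ : Ω → ℝ≥0∞} (hσ : ∀ t : ℝ≥0, MeasurableSet[ℱ t] {ω | σ ω ≤ (t : ℝ≥0∞)}) :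
    Measurable[ℱ.predictable] (cutoff f t σ) := by
  convert @measurable_ite_le_comp_sub _ ℱ.predictable _ hf t _ _ measurable_predictable_coe_fst
    (measurable_predictable_min hσ) using 1
  funext p
  simp [cutoff]

theorem measurable_predictable_running_cutoff {τ : ℕ → Ω → ℝ≥0∞}
    (hτ : ∀ (n : ℕ) (t : ℝ≥0), MeasurableSet[ℱ t] {ω | τ n ω ≤ (t : ℝ≥0∞)})
    {f : ℝ → ℝ≥0∞} (hf : Measurable f) (t : ℝ≥0)
    {σ : Ω → ℝ≥0∞} (hσ : ∀ t : ℝ≥0, MeasurableSet[ℱ t] {ω | σ ω ≤ (t : ℝ≥0∞)}) :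
    Measurable[ℱ.predictable] (runningIntegral τ (cutoff f t σ)) := by
  have key : ∀ i, Measurable[ℱ.predictable] fun p : ℝ≥0 × Ω =>
      if τ i p.2 < (p.1 : ℝ≥0∞) then cutoff f t σ ((τ i p.2).toNNReal, p.2) else 0 := by
    intro i
    convert @measurable_ite_lt _ ℱ.predictable _ _ _
      (@measurable_ite_le_comp_sub _ ℱ.predictable _ hf t _ _ (measurable_predictable_min (hτ i))
        (measurable_predictable_min hσ)) (measurable_predictable_min (hτ i))
        measurable_predictable_coe_fst using 1
    funext p
    by_cases hlt : τ i p.2 < (p.1 : ℝ≥0∞)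
    · simp [hlt, cutoff, ENNReal.coe_toNNReal hlt.ne_top,
        ENNReal.coe_toNNReal_eq_toReal, hlt.le]
    · simp [hlt]
  let : MeasurableSpace (ℝ≥0 × Ω) := ℱ.predictable
  exact Measurable.tsum key

end Predictable

/-! ### The pathwise renewal identity -/

section Pathwise

variable {h : ℝ → ℝ} {f g : ℝ → ℝ≥0∞} (μ : ℝ) (τ : ℕ → Ω → ℝ≥0∞)

/-- Separates the baseline from the excitation by each point. Since `kernel` vanishes on (-∞, 0], it
absorbs the condition that the point precede s. -/
theorem lintegral_mul_intensity (hm : Measurable h) {F : ℝ≥0 → ℝ≥0∞} (hF : Measurable F)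
    (ω : Ω) :
    ∫⁻ s, F s * intensity μ h τ s ω ∂halfLine = ENNReal.ofReal μ * ∫⁻ s, F s ∂halfLine +
      ∑' i, if τ i ω < ∞ then
        ∫⁻ s, F s * kernel h ((s : ℝ) - (τ i ω).toReal) ∂halfLine else 0 := by
  have hK := measurable_kernel hm
  have h1 : ∀ s, F s * intensity μ h τ s ω = ENNReal.ofReal μ * F s +
      ∑' i, if τ i ω < ∞ then F s * kernel h ((s : ℝ) - (τ i ω).toReal) else 0 := by
    intro s
    rw [intensity, mul_add, mul_comm (F s), ← ENNReal.tsum_mul_left]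
    congr 1
    refine tsum_congr fun i => ?_
    by_cases hi : τ i ω < ∞
    · have hiff : τ i ω < (s : ℝ≥0∞) ↔ 0 < (s : ℝ) - (τ i ω).toReal := by
        rw [sub_pos, ← ENNReal.coe_toReal s, ENNReal.toReal_lt_toReal hi.ne ENNReal.coe_ne_top]
      by_cases hlt : τ i ω < (s : ℝ≥0∞)
      · rw [if_pos hlt, if_pos hi, kernel_of_pos h (hiff.1 hlt)]
      · rw [if_neg hlt, if_pos hi, kernel_of_nonpos h (not_lt.1 (mt hiff.2 hlt))]
    · rw [if_neg hi, if_neg (fun hlt => hi (hlt.trans ENNReal.coe_lt_top)), mul_zero]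
  have h2 : ∀ i, Measurable fun s : ℝ≥0 =>
      if τ i ω < ∞ then F s * kernel h ((s : ℝ) - (τ i ω).toReal) else 0 := by
    intro i
    split_ifs
    · fun_prop
    · exact measurable_const
  simp_rw [h1]
  rw [lintegral_add_left (hF.const_mul _), lintegral_const_mul _ hF,
    lintegral_tsum fun i => (h2 i).aemeasurable]
  congr 1
  refine tsum_congr fun i => ?_
  split_ifs <;> simp

theorem lintegral_halfLine_kernel (hm : Measurable h) (hg : Measurable g) (t a : ℝ≥0) :
    ∫⁻ s : ℝ≥0, g ((t : ℝ) - s) * kernel h ((s : ℝ) - a) ∂halfLine =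
      conv (kernel h) g ((t : ℝ) - a) := by
  have hK := measurable_kernel hm
  rw [lintegral_halfLine (by fun_prop), conv,
    ← lintegral_sub_right_eq_self (fun u => kernel h u * g ((t : ℝ) - a - u)) (a : ℝ),
    ← lintegral_indicator measurableSet_Ioi]
  refine lintegral_congr fun s => ?_
  by_cases hs : 0 < s
  · rw [indicator_of_mem (by exact hs), Real.coe_toNNReal _ hs.le, mul_comm]
    congr 2
    ring
  · rw [indicator_of_notMem (by exact hs), kernel_of_nonpos, zero_mul]
    linarith [a.coe_nonneg, not_lt.1 hs]

theorem pointIntegral_cutoff_add (hgf : ∀ t, g t = f t + conv (kernel h) g t) (t : ℝ≥0)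
    (σ : Ω → ℝ≥0∞) (ω : Ω) :
    pointIntegral τ (cutoff g t σ) ω =
      pointIntegral τ (cutoff (conv (kernel h) g) t σ) ω + pointIntegral τ (cutoff f t σ) ω := by
  simp only [pointIntegral]
  rw [← ENNReal.tsum_add]
  refine tsum_congr fun i => ?_
  simp only [cutoff]
  split_ifs
  · rw [add_comm]
    exact hgf _
  all_goals simp

theorem measurable_cutoff_section (hg : Measurable g) (t : ℝ≥0) (σ : Ω → ℝ≥0∞) (ω : Ω) :
    Measurable fun s => cutoff g t σ (s, ω) := by
  simp only [cutoff]
  exact Measurable.ite (measurableSet_le (by fun_prop) measurable_const) (by fun_prop)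
    measurable_const

/-- The pathwise renewal identity, up to the random time `σ`. -/
theorem lintegral_cutoff_intensity_add_le (hm : Measurable h) (hg : Measurable g)
    (hgf : ∀ t, g t = f t + conv (kernel h) g t) (t : ℝ≥0) (σ : Ω → ℝ≥0∞) (ω : Ω) :
    ∫⁻ s, cutoff g t σ (s, ω) * intensity μ h τ s ω ∂halfLine +
        pointIntegral τ (cutoff f t σ) ω ≤
      ENNReal.ofReal μ * ∫⁻ s : ℝ≥0, g ((t : ℝ) - s) ∂halfLine +
        pointIntegral τ (cutoff g t σ) ω := by
  rw [lintegral_mul_intensity μ τ hm (measurable_cutoff_section hg t σ ω),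
    pointIntegral_cutoff_add τ hgf, ← add_assoc]
  gcongr with s
  · exact (cutoff_le_top g t σ (s, ω)).trans (cutoff_top g t (s, ω)).le
  -- A point no later than σ contributes at most its full convolution, as the cut can only lose
  -- mass. A point after σ contributes nothing, since its excitation starts after the cut. Hence an
  -- inequality where the unstopped version has equality.
  · refine ENNReal.tsum_le_tsum fun i => ?_
    by_cases hi : τ i ω < ∞
    · rw [if_pos hi, if_pos hi, ← ENNReal.coe_toNNReal_eq_toReal]
      have hcoe := ENNReal.coe_toNNReal hi.ne
      by_cases hσ : τ i ω ≤ σ ω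
      · rw [cutoff, hcoe, if_pos hσ, ← lintegral_halfLine_kernel hm hg]
        gcongr with s
        exact (cutoff_le_top g t σ (s, ω)).trans (cutoff_top g t (s, ω)).le
      · refine le_of_eq_of_le ?_ zero_le
        refine (lintegral_congr fun s => ?_).trans lintegral_zero
        by_cases hs : (s : ℝ≥0∞) ≤ σ ω
        · rw [kernel_of_nonpos, mul_zero]
          have : s < (τ i ω).toNNReal := by
            rw [← ENNReal.coe_lt_coe, hcoe]
            exact hs.trans_lt (not_le.1 hσ)
          rw [sub_nonpos]
          exact_mod_cast this.le
        · rw [cutoff, if_neg hs, zero_mul]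
    · rw [if_neg hi, if_neg hi]

/-- The pathwise renewal identity. -/
theorem lintegral_cutoff_intensity_add (hm : Measurable h) (hg : Measurable g)
    (hgf : ∀ t, g t = f t + conv (kernel h) g t) (t : ℝ≥0) (ω : Ω) :
    ∫⁻ s, cutoff g t (fun _ => ∞) (s, ω) * intensity μ h τ s ω ∂halfLine +
        pointIntegral τ (cutoff f t fun _ => ∞) ω =
      ENNReal.ofReal μ * ∫⁻ s : ℝ≥0, g ((t : ℝ) - s) ∂halfLine +
        pointIntegral τ (cutoff g t fun _ => ∞) ω := by
  rw [lintegral_mul_intensity μ τ hm (measurable_cutoff_section hg t _ ω),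
    pointIntegral_cutoff_add τ hgf, ← add_assoc]
  simp only [pointIntegral, cutoff_top]
  congr 3
  funext i
  rw [← ENNReal.coe_toNNReal_eq_toReal, lintegral_halfLine_kernel hm hg]

end Pathwise

/-! ### Bounds on point integrals and the counting variable -/

/-- Indices start at 0 and later points are strictly later, so at most n + 1 points survive the cut
at `τ n`. -/
theorem pointIntegral_le_of_index {τ : ℕ → Ω → ℝ≥0∞} {ω : Ω}
    (hlt : ∀ i j, τ i ω < ∞ → (τ j ω < τ i ω ↔ j < i)) {g : ℝ → ℝ≥0∞} {t : ℝ≥0} {C : ℝ≥0∞}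
    (hC : ∀ s : ℝ≥0, g ((t : ℝ) - s) ≤ C) (n : ℕ) :
    pointIntegral τ (cutoff g t (τ n)) ω ≤ (n + 1 : ℕ) * C := by
  calc pointIntegral τ (cutoff g t (τ n)) ω
      = ∑ i ∈ Finset.range (n + 1),
          if τ i ω < ∞ then cutoff g t (τ n) ((τ i ω).toNNReal, ω) else 0 := by
        refine tsum_eq_sum fun i hi => ?_
        have hi' : n < i := by simpa using hi
        split_ifs with h
        · have := (hlt i n h).2 hi'
          rw [cutoff, if_neg]
          rw [ENNReal.coe_toNNReal h.ne]
          exact not_le.2 this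
        · rfl
    _ ≤ ∑ i ∈ Finset.range (n + 1), C := by
        refine Finset.sum_le_sum fun i _ => ?_
        split_ifs
        · exact (cutoff_le_top g t (τ n) _).trans ((cutoff_top g t _).le.trans (hC _))
        · exact zero_le
    _ = _ := by simp

/-- The indicator of `[0, ∞)`. -/
def heaviside : ℝ → ℝ≥0∞ := (Ici 0).indicator fun _ => 1

theorem measurable_heaviside : Measurable heaviside :=
  measurable_const.indicator measurableSet_Ici

theorem heaviside_of_neg (t : ℝ) (ht : t < 0) : heaviside t = 0 :=
  indicator_of_notMem (by simpa using ht) _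

theorem heaviside_of_nonneg {t : ℝ} (ht : 0 ≤ t) : heaviside t = 1 :=
  indicator_of_mem (by simpa using ht) _

theorem pointIntegral_heaviside {τ : ℕ → Ω → ℝ≥0∞} {ω : Ω} {t : ℝ≥0}
    (hfin : {n : ℕ | τ n ω ≤ (t : ℝ≥0∞)}.Finite) :
    pointIntegral τ (cutoff heaviside t fun _ => ∞) ω = count τ t ω := by
  have hterm : ∀ n, (if τ n ω < ∞ then
      cutoff heaviside t (fun _ => ∞) ((τ n ω).toNNReal, ω) else 0) =
        if τ n ω ≤ (t : ℝ≥0∞) then 1 else 0 := by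
    intro n
    by_cases hn : τ n ω ≤ (t : ℝ≥0∞)
    · have hn' : τ n ω < ∞ := hn.trans_lt ENNReal.coe_lt_top
      rw [if_pos hn', if_pos hn, cutoff_top, heaviside_of_nonneg]
      rw [sub_nonneg]
      have : (τ n ω).toNNReal ≤ t := by
        rwa [← ENNReal.coe_le_coe, ENNReal.coe_toNNReal hn'.ne]
      exact_mod_cast this
    · rw [if_neg hn]
      split_ifs with h
      · rw [cutoff_top, heaviside_of_neg]
        have : t < (τ n ω).toNNReal := by
          rw [← ENNReal.coe_lt_coe, ENNReal.coe_toNNReal h.ne]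
          exact not_le.1 hn
        simpa using this
      · rfl
  simp_rw [pointIntegral, hterm]
  rw [tsum_eq_sum (s := hfin.toFinset) fun n hn => if_neg (by simpa using hn), count,
    ncard_eq_toFinset_card _ hfin, Finset.sum_ite_of_true (fun n hn => by simpa using hn)]
  simp

theorem eventually_lt_of_finite {τ : ℕ → Ω → ℝ≥0∞} {ω : Ω} {t : ℝ≥0}
    (hfin : {n : ℕ | τ n ω ≤ (t : ℝ≥0∞)}.Finite) :
    ∀ᶠ n in Filter.atTop, (t : ℝ≥0∞) < τ n ω := by
  have := hfin.eventually_cofinite_notMem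
  rw [Nat.cofinite_eq_atTop] at this
  filter_upwards [this] with n hn
  simpa using hn

theorem pointIntegral_le_mul_heaviside {τ : ℕ → Ω → ℝ≥0∞} {g : ℝ → ℝ≥0∞} {t : ℝ≥0} {C : ℝ≥0∞}
    (hg0 : ∀ t < 0, g t = 0) (hC : ∀ s : ℝ≥0, g ((t : ℝ) - s) ≤ C) (ω : Ω) :
    pointIntegral τ (cutoff g t fun _ => ∞) ω ≤
      C * pointIntegral τ (cutoff heaviside t fun _ => ∞) ω := by
  simp only [pointIntegral]
  rw [← ENNReal.tsum_mul_left]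
  refine ENNReal.tsum_le_tsum fun i => ?_
  split_ifs
  · rw [cutoff_top, cutoff_top]
    rcases lt_or_ge ((t : ℝ) - (τ i ω).toNNReal) 0 with h | h
    · rw [hg0 _ h]
      exact zero_le
    · rw [heaviside_of_nonneg h, mul_one]
      exact hC _
  · exact zero_le

theorem lintegral_halfLine_sub {g : ℝ → ℝ≥0∞} (hg : Measurable g) (hg0 : ∀ t < 0, g t = 0)
    (t : ℝ≥0) : ∫⁻ s : ℝ≥0, g ((t : ℝ) - s) ∂halfLine = ∫⁻ s in Ioc 0 (t : ℝ), g s := by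
  rw [lintegral_halfLine (by fun_prop), ← lintegral_indicator measurableSet_Ioi,
    ← lintegral_indicator measurableSet_Ioc,
    ← lintegral_sub_left_eq_self ((Ioc 0 (t : ℝ)).indicator fun s => g s) (t : ℝ)]
  refine lintegral_congr_ae ?_
  have h0 : ∀ᵐ s : ℝ, s ≠ 0 := by simp [ae_iff]
  have h1 : ∀ᵐ s : ℝ, s ≠ t := by simp [ae_iff]
  filter_upwards [h0, h1] with s hs0 hs1
  rcases lt_or_gt_of_ne hs0 with h | h
  · rw [indicator_of_notMem (by simpa using h.le), indicator_of_notMem]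
    intro h'
    linarith [h'.2]
  · rw [indicator_of_mem (by exact h), Real.coe_toNNReal _ h.le]
    rcases lt_or_gt_of_ne hs1 with h2 | h2
    · rw [indicator_of_mem (by constructor <;> linarith)]
    · rw [hg0 _ (by linarith), indicator_of_notMem]
      intro h'
      linarith [h'.1]

theorem lintegral_halfLine_sub_ne_top {g : ℝ → ℝ≥0∞} (hg : Measurable g)
    (hg0 : ∀ t < 0, g t = 0) {t : ℝ≥0} {C : ℝ≥0∞} (hCtop : C ≠ ∞)
    (hC : ∀ s : ℝ≥0, g ((t : ℝ) - s) ≤ C) : ∫⁻ s : ℝ≥0, g ((t : ℝ) - s) ∂halfLine ≠ ∞ := by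
  rw [lintegral_halfLine_sub hg hg0]
  have hle : ∫⁻ s in Ioc 0 (t : ℝ), g s ≤ ∫⁻ _ in Ioc 0 (t : ℝ), C := by
    refine setLIntegral_mono' measurableSet_Ioc fun s hs => ?_
    have := hC (t - s).toNNReal
    rwa [Real.coe_toNNReal _ (by linarith [hs.2]), sub_sub_cancel] at this
  refine ne_top_of_le_ne_top ?_ hle
  simp only [lintegral_const, Measure.restrict_apply MeasurableSet.univ, univ_inter,
    Real.volume_Ioc]
  finiteness

/-- Makes the constant ∞ an admissible stopping time, so the unstopped integrals are a special case
of the stopped ones. -/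
theorem measurableSet_top_le (m : MeasurableSpace Ω) (t : ℝ≥0) :
    MeasurableSet[m] {_ω : Ω | (∞ : ℝ≥0∞) ≤ (t : ℝ≥0∞)} := by
  simp

/-! ### First and second moments -/

section Moments

variable {mΩ : MeasurableSpace Ω} {P : Measure Ω} {ℱ : Filtration ℝ≥0 mΩ}
  {τ : ℕ → Ω → ℝ≥0∞} {μ : ℝ} {h : ℝ → ℝ} {f g : ℝ → ℝ≥0∞}

theorem IsHawkesProcess.lintegral_cutoff (hτ : IsHawkesProcess P ℱ μ h τ) (hm : Measurable h)
    (hg : Measurable g) (t : ℝ≥0) {σ : Ω → ℝ≥0∞}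
    (hσ : ∀ t : ℝ≥0, MeasurableSet[ℱ t] {ω | σ ω ≤ (t : ℝ≥0∞)}) :
    ∫⁻ ω, pointIntegral τ (cutoff g t σ) ω ∂P =
      ∫⁻ ω, ∫⁻ s, cutoff g t σ (s, ω) * intensity μ h τ s ω ∂halfLine ∂P :=
  hτ.hasIntensity.lintegral_eq
    ((measurable_predictable_intensity μ hm hτ.isSimplePointProcess.adapted).mono
      predictable_le_prod le_rfl) (measurable_predictable_cutoff hg t hσ)

theorem measurable_pointIntegral_cutoff (hτ : IsSimplePointProcess P ℱ τ)
    (hg : Measurable g) (t : ℝ≥0) {σ : Ω → ℝ≥0∞}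
    (hσ : ∀ t : ℝ≥0, MeasurableSet[ℱ t] {ω | σ ω ≤ (t : ℝ≥0∞)}) :
    Measurable (pointIntegral τ (cutoff g t σ)) :=
  measurable_pointIntegral hτ ((measurable_predictable_cutoff hg t hσ).mono predictable_le_prod
    le_rfl)

/-- Stopped at `τ n`, the integral of g is bounded and has the same expectation as its compensator,
so both cancel from the expected pathwise inequality; Fatou then lets n tend to infinity. For the
count, this supplies the finiteness needed to apply `lintegral_pointIntegral_eq`. -/
theorem IsHawkesProcess.lintegral_pointIntegral_le [IsProbabilityMeasure P]
    (hτ : IsHawkesProcess P ℱ μ h τ)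
    (hm : Measurable h) (hf : Measurable f) (hf0 : ∀ t < 0, f t = 0) (hg : Measurable g)
    (hgf : ∀ t, g t = f t + conv (kernel h) g t) {t : ℝ≥0} {C : ℝ≥0∞} (hCtop : C ≠ ∞)
    (hC : ∀ s : ℝ≥0, g ((t : ℝ) - s) ≤ C) :
    ∫⁻ ω, pointIntegral τ (cutoff f t fun _ => ∞) ω ∂P ≤
      ENNReal.ofReal μ * ∫⁻ s : ℝ≥0, g ((t : ℝ) - s) ∂halfLine := by
  have hsp := hτ.isSimplePointProcess
  refine lintegral_le_of_eventually_eq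
    (F := fun n => pointIntegral τ (cutoff f t (τ n)))
    (fun n => measurable_pointIntegral_cutoff hsp hf t (hsp.adapted n)) ?_ fun n => ?_
  · filter_upwards [hsp.locallyFinite] with ω hω
    filter_upwards [eventually_lt_of_finite (hω t)] with n hn
    exact pointIntegral_congr τ fun s => cutoff_eq_top hf0 hn
  · have hfin : ∫⁻ ω, pointIntegral τ (cutoff g t (τ n)) ω ∂P ≠ ∞ := by
      refine ne_top_of_le_ne_top (b := ∫⁻ _, (n + 1 : ℕ) * C ∂P) ?_ ?_
      · simp only [lintegral_const, measure_univ]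
        finiteness
      · refine lintegral_mono_ae ?_
        filter_upwards [hsp.ae_lt_iff] with ω hω using pointIntegral_le_of_index hω hC n
    have hle := lintegral_mono (μ := P)
      fun ω => lintegral_cutoff_intensity_add_le μ τ hm hg hgf t (τ n) ω
    rw [lintegral_add_right _ (measurable_pointIntegral_cutoff hsp hf t (hsp.adapted n)),
      lintegral_add_left measurable_const,
      ← hτ.lintegral_cutoff hm hg t (hsp.adapted n), lintegral_const, measure_univ, mul_one,
      add_comm] at hle
    exact (ENNReal.add_le_add_iff_right hfin).1 hle

theorem IsHawkesProcess.lintegral_pointIntegral_eq [IsProbabilityMeasure P]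
    (hτ : IsHawkesProcess P ℱ μ h τ)
    (hm : Measurable h) (hf : Measurable f) (hg : Measurable g)
    (hgf : ∀ t, g t = f t + conv (kernel h) g t) {t : ℝ≥0}
    (hfin : ∫⁻ ω, pointIntegral τ (cutoff g t fun _ => ∞) ω ∂P ≠ ∞) :
    ∫⁻ ω, pointIntegral τ (cutoff f t fun _ => ∞) ω ∂P =
      ENNReal.ofReal μ * ∫⁻ s : ℝ≥0, g ((t : ℝ) - s) ∂halfLine := by
  have hsp := hτ.isSimplePointProcess
  have htop := fun t : ℝ≥0 => measurableSet_top_le (ℱ t) t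
  have heq := lintegral_congr (μ := P)
    fun ω => lintegral_cutoff_intensity_add μ τ hm hg hgf t ω
  rw [lintegral_add_right _ (measurable_pointIntegral_cutoff hsp hf t htop),
    lintegral_add_left measurable_const,
    ← hτ.lintegral_cutoff hm hg t htop, lintegral_const, measure_univ, mul_one,
    add_comm] at heq
  exact (ENNReal.add_left_inj hfin).1 heq

theorem cutoff_sq (g : ℝ → ℝ≥0∞) (t : ℝ≥0) (σ : Ω → ℝ≥0∞) (p : ℝ≥0 × Ω) :
    cutoff g t σ p ^ 2 = cutoff (fun s => g s ^ 2) t σ p := by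
  simp only [cutoff]
  split_ifs <;> simp

theorem IsHawkesProcess.lintegral_sq_compensated_cutoff [IsProbabilityMeasure P]
    (hτ : IsHawkesProcess P ℱ μ h τ)
    (hm : Measurable h) (hg : Measurable g) (t : ℝ≥0) {σ : Ω → ℝ≥0∞}
    (hσ : ∀ t : ℝ≥0, MeasurableSet[ℱ t] {ω | σ ω ≤ (t : ℝ≥0∞)})
    (hY : ∫⁻ ω, pointIntegral τ (cutoff g t σ) ω ^ 2 ∂P ≠ ∞)
    (hA : ∫⁻ ω, (∫⁻ s, cutoff g t σ (s, ω) * intensity μ h τ s ω ∂halfLine) ^ 2 ∂P ≠ ∞) :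
    ∫⁻ ω, ENNReal.ofReal (((pointIntegral τ (cutoff g t σ) ω).toReal -
        (∫⁻ s, cutoff g t σ (s, ω) * intensity μ h τ s ω ∂halfLine).toReal) ^ 2) ∂P =
      ∫⁻ ω, pointIntegral τ (cutoff (fun s => g s ^ 2) t σ) ω ∂P := by
  have hsp := hτ.isSimplePointProcess
  rw [lintegral_sq_compensated hsp hτ.hasIntensity
    (measurable_predictable_intensity μ hm hsp.adapted) (measurable_predictable_cutoff hg t hσ)
    (measurable_predictable_running_cutoff hsp.adapted hg t hσ) hY hA,
    hτ.lintegral_cutoff hm (hg.pow_const 2) t hσ]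
  simp_rw [cutoff_sq]

/-- First and second moments of the number of points in `(0, t]`, with values in `[0, ∞]`. -/
theorem IsHawkesProcess.lintegral_count [IsProbabilityMeasure P]
    (hτ : IsHawkesProcess P ℱ μ h τ) (hm : Measurable h)
    {g₁ g₂ : ℝ → ℝ≥0∞} (hg₁ : Measurable g₁) (hg₂ : Measurable g₂)
    (hg₁0 : ∀ t < 0, g₁ t = 0) (hg₂0 : ∀ t < 0, g₂ t = 0)
    (heq₁ : ∀ t, g₁ t = heaviside t + conv (kernel h) g₁ t)
    (heq₂ : ∀ t, g₂ t = g₁ t ^ 2 + conv (kernel h) g₂ t)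
    {t : ℝ≥0} {C₁ C₂ : ℝ≥0∞} (hC₁top : C₁ ≠ ∞) (hC₂top : C₂ ≠ ∞)
    (hC₁ : ∀ s : ℝ≥0, g₁ ((t : ℝ) - s) ≤ C₁) (hC₂ : ∀ s : ℝ≥0, g₂ ((t : ℝ) - s) ≤ C₂)
    {m V : ℝ≥0∞} (hmdef : m = ENNReal.ofReal μ * ∫⁻ s : ℝ≥0, g₁ ((t : ℝ) - s) ∂halfLine)
    (hVdef : V = ENNReal.ofReal μ * ∫⁻ s : ℝ≥0, g₂ ((t : ℝ) - s) ∂halfLine) :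
    ∫⁻ ω, pointIntegral τ (cutoff heaviside t fun _ => ∞) ω ∂P = m ∧
    ∫⁻ ω, pointIntegral τ (cutoff heaviside t fun _ => ∞) ω ^ 2 ∂P ≠ ∞ ∧
    ∫⁻ ω, ENNReal.ofReal (((pointIntegral τ (cutoff heaviside t fun _ => ∞) ω).toReal -
      m.toReal) ^ 2) ∂P = V := by
  have hsp := hτ.isSimplePointProcess
  have htop := fun t : ℝ≥0 => measurableSet_top_le (ℱ t) t
  have hg₁sq : Measurable fun s => g₁ s ^ 2 := hg₁.pow_const 2
  have hg₁sq0 : ∀ t < 0, g₁ t ^ 2 = 0 := fun t ht => by simp [hg₁0 t ht]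
  have hm_top : m ≠ ∞ := by
    rw [hmdef]
    exact ENNReal.mul_ne_top ENNReal.ofReal_ne_top
      (lintegral_halfLine_sub_ne_top hg₁ hg₁0 hC₁top hC₁)
  have hV_top : V ≠ ∞ := by
    rw [hVdef]
    exact ENNReal.mul_ne_top ENNReal.ofReal_ne_top
      (lintegral_halfLine_sub_ne_top hg₂ hg₂0 hC₂top hC₂)
  have hpath := lintegral_cutoff_intensity_add μ τ hm hg₁ heq₁ t
  have hpath_le := lintegral_cutoff_intensity_add_le μ τ hm hg₁ heq₁ t
  rw [← hmdef] at hpath hpath_le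
  set N := pointIntegral τ (cutoff heaviside t fun _ => ∞) with hN
  set Y := pointIntegral τ (cutoff g₁ t fun _ => ∞) with hYdef
  set A : Ω → ℝ≥0∞ := fun ω =>
    ∫⁻ s, cutoff g₁ t (fun _ => ∞) (s, ω) * intensity μ h τ s ω ∂halfLine with hAdef
  have hNm : Measurable N := measurable_pointIntegral_cutoff hsp measurable_heaviside t htop
  have hN_le : ∫⁻ ω, N ω ∂P ≤ m := hmdef ▸ hτ.lintegral_pointIntegral_le hm measurable_heaviside
    heaviside_of_neg hg₁ heq₁ hC₁top hC₁
  have hN_top : ∫⁻ ω, N ω ∂P ≠ ∞ := ne_top_of_le_ne_top hm_top hN_le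
  have hY_le : ∀ ω, Y ω ≤ C₁ * N ω := pointIntegral_le_mul_heaviside hg₁0 hC₁
  have hY_top : ∫⁻ ω, Y ω ∂P ≠ ∞ := by
    refine ne_top_of_le_ne_top ?_ (lintegral_mono hY_le)
    rw [lintegral_const_mul _ hNm]
    finiteness
  have hmean : ∫⁻ ω, N ω ∂P = m :=
    hmdef ▸ hτ.lintegral_pointIntegral_eq hm measurable_heaviside hg₁ heq₁ hY_top
  -- The renewal identity a second time, with forcing g₁² and solution g₂: this is where g₂ enters.
  have hQ : ∫⁻ ω, pointIntegral τ (cutoff (fun s => g₁ s ^ 2) t fun _ => ∞) ω ∂P = V := by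
    rw [hVdef]
    refine hτ.lintegral_pointIntegral_eq hm hg₁sq hg₂ heq₂ ?_
    refine ne_top_of_le_ne_top ?_
      (lintegral_mono (pointIntegral_le_mul_heaviside hg₂0 hC₂))
    rw [lintegral_const_mul _ hNm]
    finiteness
  have hlam : Measurable fun p : ℝ≥0 × Ω => intensity μ h τ p.1 p.2 :=
    (measurable_predictable_intensity μ hm hsp.adapted).mono predictable_le_prod le_rfl
  -- The isometry applies to the stopped integral, whose compensator is at most m + (n + 1) C₁ by
  -- the pathwise inequality; dropping the cut on the right bounds it by V uniformly in n.
  have hstopped : ∀ n, ∫⁻ ω, ENNReal.ofReal (((pointIntegral τ (cutoff g₁ t (τ n)) ω).toReal -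
      (∫⁻ s, cutoff g₁ t (τ n) (s, ω) * intensity μ h τ s ω ∂halfLine).toReal) ^ 2) ∂P ≤ V := by
    intro n
    have hYn : ∀ᵐ ω ∂P, pointIntegral τ (cutoff g₁ t (τ n)) ω ≤ (n + 1 : ℕ) * C₁ := by
      filter_upwards [hsp.ae_lt_iff] with ω hω using pointIntegral_le_of_index hω hC₁ n
    have hbdd : ∀ {Z : Ω → ℝ≥0∞} {B : ℝ≥0∞}, B ≠ ∞ → (∀ᵐ ω ∂P, Z ω ≤ B) →
        ∫⁻ ω, Z ω ^ 2 ∂P ≠ ∞ := by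
      intro Z B hB hZ
      refine ne_top_of_le_ne_top (b := ∫⁻ _, B ^ 2 ∂P) ?_ (lintegral_mono_ae ?_)
      · simp only [lintegral_const, measure_univ]
        finiteness
      · filter_upwards [hZ] with ω hω
        gcongr
    rw [hτ.lintegral_sq_compensated_cutoff hm hg₁ t (hsp.adapted n)
      (hbdd (B := (n + 1 : ℕ) * C₁) (by finiteness) hYn)
      (hbdd (B := m + (n + 1 : ℕ) * C₁) (by finiteness) ?_), ← hQ]
    · exact lintegral_mono fun ω => pointIntegral_mono τ fun s => cutoff_le_top _ _ _ _
    · filter_upwards [hYn] with ω hω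
      exact (le_self_add.trans (hpath_le (τ n) ω)).trans (by gcongr)
  have hYA_le : ∫⁻ ω, ENNReal.ofReal (((Y ω).toReal - (A ω).toReal) ^ 2) ∂P ≤ V := by
    refine lintegral_le_of_eventually_eq
      (F := fun n ω => ENNReal.ofReal (((pointIntegral τ (cutoff g₁ t (τ n)) ω).toReal -
        (∫⁻ s, cutoff g₁ t (τ n) (s, ω) * intensity μ h τ s ω ∂halfLine).toReal) ^ 2))
      (fun n => ?_) ?_ hstopped
    · have h1 := measurable_pointIntegral_cutoff hsp hg₁ t (hsp.adapted n)
      have hc : Measurable (cutoff g₁ t (τ n)) :=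
        (measurable_predictable_cutoff hg₁ t (hsp.adapted n)).mono predictable_le_prod le_rfl
      have h2 : Measurable fun ω =>
          ∫⁻ s, cutoff g₁ t (τ n) (s, ω) * intensity μ h τ s ω ∂halfLine :=
        ((hc.mul hlam).comp measurable_swap).lintegral_prod_right'
      fun_prop
    · filter_upwards [hsp.locallyFinite] with ω hω
      filter_upwards [eventually_lt_of_finite (hω t)] with n hn
      have hc : ∀ s, cutoff g₁ t (τ n) (s, ω) = cutoff g₁ t (fun _ => ∞) (s, ω) :=
        fun s => cutoff_eq_top hg₁0 hn
      simp_rw [pointIntegral_congr τ hc, hc]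
      rfl
  -- The centred count is the compensated integral of g₁(t - s).
  have hdiff : ∀ᵐ ω ∂P, (Y ω).toReal - (A ω).toReal = (N ω).toReal - m.toReal := by
    filter_upwards [ae_lt_top hNm hN_top] with ω hω
    have hYω : Y ω ≠ ∞ := ne_top_of_le_ne_top (by finiteness) (hY_le ω)
    have hp : A ω + N ω = m + Y ω := hpath ω
    have hAω : A ω ≠ ∞ := by
      refine ne_top_of_le_ne_top (b := m + Y ω) (by finiteness) ?_
      exact le_self_add.trans hp.le
    have := congrArg ENNReal.toReal hp
    rw [ENNReal.toReal_add hAω hω.ne, ENNReal.toReal_add hm_top hYω] at this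
    linarith
  have hdiff' : ∫⁻ ω, ENNReal.ofReal (((N ω).toReal - m.toReal) ^ 2) ∂P =
      ∫⁻ ω, ENNReal.ofReal (((Y ω).toReal - (A ω).toReal) ^ 2) ∂P := by
    refine lintegral_congr_ae ?_
    filter_upwards [hdiff] with ω hω
    rw [hω]
  -- Uses N² ≤ (N - m)² + 2 m N, with the first term controlled by V through Fatou. This
  -- square-integrability passes to Y and A and permits the unstopped isometry, upgrading the bound
  -- by V to equality.
  have hN2 : ∫⁻ ω, N ω ^ 2 ∂P ≠ ∞ := by
    have hle : ∫⁻ ω, N ω ^ 2 ∂P ≤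
        ∫⁻ ω, (ENNReal.ofReal (((N ω).toReal - m.toReal) ^ 2) + 2 * m * N ω) ∂P := by
      refine lintegral_mono_ae ?_
      filter_upwards [ae_lt_top hNm hN_top] with ω hω
      have := ofReal_sub_sq_add hω.ne hm_top
      calc N ω ^ 2 ≤ N ω ^ 2 + m ^ 2 := le_self_add
        _ = _ := by
          rw [← this]
          ring
    refine ne_top_of_le_ne_top ?_ hle
    rw [lintegral_add_right _ (by fun_prop), lintegral_const_mul _ hNm, hdiff']
    exact ENNReal.add_ne_top.2 ⟨ne_top_of_le_ne_top hV_top hYA_le, by finiteness⟩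
  refine ⟨hmean, hN2, ?_⟩
  have hY2 : ∫⁻ ω, Y ω ^ 2 ∂P ≠ ∞ := by
    refine ne_top_of_le_ne_top (b := ∫⁻ ω, C₁ ^ 2 * N ω ^ 2 ∂P) ?_ (lintegral_mono fun ω => ?_)
    · rw [lintegral_const_mul _ (hNm.pow_const 2)]
      finiteness
    · change Y ω ^ 2 ≤ _
      rw [← mul_pow]
      gcongr
      exact hY_le ω
  have hA2 : ∫⁻ ω, A ω ^ 2 ∂P ≠ ∞ := by
    refine ne_top_of_le_ne_top
      (b := ∫⁻ ω, (m ^ 2 + 2 * m * C₁ * N ω + C₁ ^ 2 * N ω ^ 2) ∂P) ?_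
      (lintegral_mono fun ω => ?_)
    · rw [lintegral_add_right _ (by fun_prop), lintegral_add_left measurable_const,
        lintegral_const_mul _ hNm, lintegral_const_mul _ (hNm.pow_const 2), lintegral_const,
        measure_univ]
      finiteness
    · change A ω ^ 2 ≤ _
      have hle : A ω ≤ m + C₁ * N ω :=
        (le_self_add.trans (hpath ω).le).trans (by gcongr; exact hY_le ω)
      calc A ω ^ 2 ≤ (m + C₁ * N ω) ^ 2 := by gcongr
        _ = _ := by ring
  rw [hdiff', ← hQ]
  exact hτ.lintegral_sq_compensated_cutoff hm hg₁ t htop hY2 hA2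

theorem toReal_mul_lintegral (hμ : 0 ≤ μ) (hg : Measurable g) (hg0 : ∀ t < 0, g t = 0)
    {t : ℝ≥0} (hfin : ∀ s, g s ≠ ∞) {g' : ℝ → ℝ} (hg' : ∀ s, 0 ≤ s → g' s = (g s).toReal) :
    (ENNReal.ofReal μ * ∫⁻ s : ℝ≥0, g ((t : ℝ) - s) ∂halfLine).toReal =
      μ * ∫ s in (0 : ℝ)..t, g' s := by
  rw [lintegral_halfLine_sub hg hg0, ENNReal.toReal_mul, ENNReal.toReal_ofReal hμ,
    intervalIntegral.integral_of_le t.coe_nonneg]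
  congr 1
  rw [← integral_toReal hg.aemeasurable (Filter.Eventually.of_forall fun s => (hfin s).lt_top)]
  refine setIntegral_congr_fun measurableSet_Ioc fun s hs => ?_
  exact (hg' s hs.1.le).symm

end Moments

/-! ### The two resolvents, and passage to real-valued moments -/

theorem exists_resolvents {h : ℝ → ℝ} (hm : Measurable h) (h_int : IntegrableOn h (Ici 0)) :
    ∃ (θ : ℝ) (g₁ g₂ : ℝ → ℝ≥0∞), 0 ≤ θ ∧ Measurable g₁ ∧ Measurable g₂ ∧
      (∀ t < 0, g₁ t = 0) ∧ (∀ t < 0, g₂ t = 0) ∧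
      (∀ t, g₁ t ≤ 2 * ENNReal.ofReal (Real.exp (θ * t))) ∧
      (∀ t, g₂ t ≤ 8 * ENNReal.ofReal (Real.exp (θ * t))) ∧
      (∀ t, g₁ t = heaviside t + conv (kernel h) g₁ t) ∧
      ∀ t, g₂ t = g₁ t ^ 2 + conv (kernel h) g₂ t := by
  obtain ⟨θ, hθ0, hθ⟩ := exists_discount hm h_int
  obtain ⟨g₁, hg₁, hg₁0, hg₁M, heq₁⟩ := exists_renewal (M := 1) hm hθ measurable_heaviside
    heaviside_of_neg fun t => by
      rcases lt_or_ge t 0 with ht | ht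
      · rw [heaviside_of_neg t ht]
        exact zero_le
      · rw [heaviside_of_nonneg ht, one_mul, ENNReal.one_le_ofReal, Real.one_le_exp_iff]
        positivity
  -- The forcing g₁² grows at rate 2θ, and discounting faster only decreases the mass. The constants
  -- are 2 for g₁, 2² = 4 for its square and 2 · 4 = 8 for g₂.
  have hθ2 : ∫⁻ u, kernel h u * ENNReal.ofReal (Real.exp (-(2 * θ) * u)) ≤ 2⁻¹ := by
    refine (lintegral_mono fun u => ?_).trans hθ
    rcases le_or_gt u 0 with hu | hu
    · simp [kernel_of_nonpos h hu]
    · gcongr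
      nlinarith
  obtain ⟨g₂, hg₂, hg₂0, hg₂M, heq₂⟩ := exists_renewal (M := 4) (f := fun t => g₁ t ^ 2) hm hθ2
    (hg₁.pow_const 2) (fun t ht => by simp [hg₁0 t ht]) fun t => by
      calc g₁ t ^ 2 ≤ ((1 * 2) * ENNReal.ofReal (Real.exp (θ * t))) ^ 2 := by
            gcongr
            exact hg₁M t
        _ = 4 * ENNReal.ofReal (Real.exp (2 * θ * t)) := by
            rw [mul_pow, ← ENNReal.ofReal_pow (Real.exp_nonneg _), ← Real.exp_nat_mul]
            norm_num
            congr 3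
            ring
  refine ⟨2 * θ, g₁, g₂, by positivity, hg₁, hg₂, hg₁0, hg₂0, fun t => ?_, fun t => ?_, heq₁, heq₂⟩
  · rcases lt_or_ge t 0 with ht | ht
    · rw [hg₁0 t ht]
      exact zero_le
    · refine (hg₁M t).trans ?_
      rw [one_mul]
      gcongr
      linarith
  · refine (hg₂M t).trans (le_of_eq ?_)
    norm_num

end Hawkes

end

theorem proposition1 {Ω : Type*} [mΩ : MeasurableSpace Ω] (P : Measure Ω) [IsProbabilityMeasure P]
    (ℱ : Filtration ℝ≥0 mΩ) (μ : ℝ) (hμ : 0 ≤ μ)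
    (h : ℝ → ℝ) (h_meas : Measurable h) (h_nonneg : ∀ t : ℝ, 0 ≤ t → 0 ≤ h t)
    (h_int : IntegrableOn h (Ici 0))
    (τ : ℕ → Ω → ℝ≥0∞) (hτ : Hawkes.IsHawkesProcess P ℱ μ h τ) :
    (∃ g₁ g₂ : ℝ → ℝ, Hawkes.SolvesRenewal h (fun _ => 1) g₁ ∧
      Hawkes.SolvesRenewal h (fun t => g₁ t ^ 2) g₂) ∧
    ∀ g₁ g₂ : ℝ → ℝ, Hawkes.SolvesRenewal h (fun _ => 1) g₁ →
      Hawkes.SolvesRenewal h (fun t => g₁ t ^ 2) g₂ →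
      ∀ t : ℝ≥0,
        (Integrable (fun ω => (Hawkes.count τ t ω : ℝ)) P ∧
          ∫ ω, (Hawkes.count τ t ω : ℝ) ∂P = μ * ∫ s in (0 : ℝ)..t, g₁ s) ∧
        (MemLp (fun ω => (Hawkes.count τ t ω : ℝ)) 2 P ∧
          variance (fun ω => (Hawkes.count τ t ω : ℝ)) P = μ * ∫ s in (0 : ℝ)..t, g₂ s) := by
  obtain ⟨θ, G₁, G₂, hθ, hG₁, hG₂, hG₁0, hG₂0, hG₁M, hG₂M, heq₁, heq₂⟩ :=
    Hawkes.exists_resolvents h_meas h_int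
  have hG₁fin : ∀ s, G₁ s ≠ ∞ := fun s => ne_top_of_le_ne_top (by finiteness) (hG₁M s)
  have hG₂fin : ∀ s, G₂ s ≠ ∞ := fun s => ne_top_of_le_ne_top (by finiteness) (hG₂M s)
  have hsol₁ : Hawkes.SolvesRenewal h (fun _ => 1) fun t => (G₁ t).toReal :=
    Hawkes.solvesRenewal_toReal h_nonneg h_meas (by finiteness) hG₁ hG₁0 hG₁M heq₁
      fun t ht => by simp [Hawkes.heaviside_of_nonneg ht]
  refine ⟨⟨fun t => (G₁ t).toReal, fun t => (G₂ t).toReal, hsol₁,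
    Hawkes.solvesRenewal_toReal h_nonneg h_meas (by finiteness) hG₂ hG₂0 hG₂M heq₂
      fun t _ => by simp⟩, ?_⟩
  intro g₁ g₂ hg₁ hg₂ t
  have hgG₁ : ∀ s, 0 ≤ s → g₁ s = (G₁ s).toReal := fun s hs =>
    hg₁.unique h_nonneg h_meas h_int hsol₁ hs
  -- The given g₂ is driven by the given g₁, so uniqueness for g₁ comes first: it shows that `G₂`
  -- solves the same equation as g₂.
  have hsol₂ : Hawkes.SolvesRenewal h (fun t => g₁ t ^ 2) fun t => (G₂ t).toReal :=
    Hawkes.solvesRenewal_toReal h_nonneg h_meas (by finiteness) hG₂ hG₂0 hG₂M heq₂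
      fun t ht => by simp [hgG₁ t ht]
  have hgG₂ : ∀ s, 0 ≤ s → g₂ s = (G₂ s).toReal := fun s hs =>
    hg₂.unique h_nonneg h_meas h_int hsol₂ hs
  have hbound : ∀ {G : ℝ → ℝ≥0∞} {M : ℝ≥0∞},
      (∀ t, G t ≤ M * ENNReal.ofReal (Real.exp (θ * t))) →
      ∀ s : ℝ≥0, G ((t : ℝ) - s) ≤ M * ENNReal.ofReal (Real.exp (θ * t)) := by
    intro G M hGM s
    refine (hGM _).trans ?_
    gcongr
    linarith [s.coe_nonneg]
  obtain ⟨hmean, hsq, hvar⟩ := hτ.lintegral_count h_meas hG₁ hG₂ hG₁0 hG₂0 heq₁ heq₂ (t := t)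
    (by finiteness) (by finiteness) (hbound hG₁M) (hbound hG₂M) rfl rfl
  have hmR := Hawkes.toReal_mul_lintegral hμ hG₁ hG₁0 (t := t) hG₁fin hgG₁
  have hVR := Hawkes.toReal_mul_lintegral hμ hG₂ hG₂0 (t := t) hG₂fin hgG₂
  have hsp := hτ.isSimplePointProcess
  set N := Hawkes.pointIntegral τ (Hawkes.cutoff Hawkes.heaviside t fun _ => ∞)
  have hNm : Measurable N := Hawkes.measurable_pointIntegral_cutoff hsp
    Hawkes.measurable_heaviside t fun t => Hawkes.measurableSet_top_le (ℱ t) t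
  have hcount : ∀ᵐ ω ∂P, N ω = Hawkes.count τ t ω := by
    filter_upwards [hsp.locallyFinite] with ω hω using Hawkes.pointIntegral_heaviside (hω t)
  have hX : (fun ω => (Hawkes.count τ t ω : ℝ)) =ᵐ[P] fun ω => (N ω).toReal := by
    filter_upwards [hcount] with ω hω
    rw [hω, ENNReal.toReal_natCast]
  have hNtop : ∀ᵐ ω ∂P, N ω < ∞ := by
    filter_upwards [hcount] with ω hω
    rw [hω]
    exact ENNReal.natCast_lt_top _
  have hL2 : MemLp (fun ω => (N ω).toReal) 2 P := by
    rw [memLp_two_iff_integrable_sq hNm.ennreal_toReal.aestronglyMeasurable]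
    refine ⟨(hNm.ennreal_toReal.pow_const 2).aestronglyMeasurable, ?_⟩
    rw [hasFiniteIntegral_iff_ofReal (Filter.Eventually.of_forall fun ω => sq_nonneg _)]
    refine lt_of_le_of_lt (lintegral_mono fun ω => ?_) hsq.lt_top
    rw [ENNReal.ofReal_pow ENNReal.toReal_nonneg]
    gcongr
    exact ENNReal.ofReal_toReal_le
  have hE : ∫ ω, (N ω).toReal ∂P = μ * ∫ s in (0 : ℝ)..t, g₁ s := by
    rw [integral_toReal hNm.aemeasurable hNtop, hmean, hmR]
  refine ⟨⟨(hL2.integrable one_le_two).congr hX.symm, ?_⟩, (memLp_congr_ae hX).2 hL2, ?_⟩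
  · rw [integral_congr_ae hX, hE]
  · rw [variance_congr hX, variance_eq_integral hNm.ennreal_toReal.aemeasurable, hE,
      integral_eq_lintegral_of_nonneg_ae (Filter.Eventually.of_forall fun ω => sq_nonneg _)
        ((hNm.ennreal_toReal.sub_const _).pow_const 2).aestronglyMeasurable, ← hmR, hvar, hVR]
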